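/- **Machine model.** Consider a word RAM with word size $w$. The input occupies $N$ words $A[0],\dots,A[N-1]$, which may be read and written; besides them a program has only a constant number of registers of one word each (so the program is in-place). In one time step a program may load a constant, copy a register, add, subtract, multiply or shift the contents of two registers (results are taken modulo $2^w$), read or write a word of $A$ whose address is in a register, jump unconditionally, jump if one register is smaller than (or equal to) another, or call one of two user-defined functions `preprocess`, `postprocess` on the content of a register. The user-defined functions work on memory of their own, and each call counts as one step. A program is one fixed finite list of instructions, independent of $w$ and of the input. **Input.** Let $n\ge 1$ and let $G$ be a directed graph with vertex set $V=\{1,\dots,n\}$ and $m$ arcs (without parallel arcs, loops allowed). The *sorted standard representation* of $G$ is the array $$A=(\,n,\;T[1],\dots,T[n],\;M,\;L_1,L_2,\dots,L_n\,),$$ where $L_v$ is the list of the out-neighbours of $v$ in ascending order, $M=\sum_v |L_v|$, and $T[v]=n+2+\sum_{u<v}|L_u|$ is the position in $A$ (counted from $0$) at which $L_v$ starts. An undirected (simple) graph is represented in the same way, with each edge stored at both of its endpoints. **Depth-first search.** At first all vertices are white. To visit a white vertex $u$ means: colour $u$ gray and call `preprocess`$(u)$; go through the out-neighbours of $u$,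 in some order, and visit each one that is white when its turn comes; then colour $u$ black and call `postprocess`$(u)$. A *DFS from $s$* visits the start vertex $s$ (and thereby everything reachable from $s$). A *full DFS started at $s$* visits $s$ first and afterwards is started again at a white vertex as long as there is one. **Theorem.** There are a program $P$, a program $Q$ and a constant $C$ such that the following holds for every directed graph $G$ with vertex set $\{1,\dots,n\}$ and $m$ arcs and every vertex $s$. The sorted standard representation $A$ of $G$ consists of $N=n+m+2$ words. For every word size $w$ with $N<2^w$, each of the two programs, started with $A$ in the input memory and $s$ in its first register (all other registers being $0$), halts after at most $C\,(n+m)$ steps without having accessed any memory outside $A$ and its registers, and the input memory then contains $A$ again. The calls of `preprocess` and `postprocess` that $P$ makes are, in order, exactly those of a DFS from $s$, and the calls that $Q$ makes are exactly those of a full DFS started at $s$. The same holds, with the same $P$, $Q$, $C$, for every undirected graph $G$ with vertex set $\{1,\dots,n\}$ and $m$ edges, with $N=n+2m+2$ words and again at most $C\,(n+m)$ steps. -/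

import Mathlib

namespace InPlaceDFS

/-! ### The word RAM with in-place programs -/

/-- Instructions of a word RAM with `k` registers (the working memory). Jump targets are indices
into the program. Constants are reduced modulo `2 ^ w`. -/
inductive Instr (k : ℕ) where
  /-- `dst := c` -/
  | const (dst : Fin k) (c : ℕ)
  /-- `dst := a` -/
  | copy (dst a : Fin k)
  /-- `dst := a + b` -/
  | add (dst a b : Fin k)
  /-- `dst := a - b` -/
  | sub (dst a b : Fin k)
  /-- `dst := a * b` -/
  | mul (dst a b : Fin k)
  /-- `dst := a <<< b` -/
  | shl (dst a b : Fin k)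
  /-- `dst := a >>> b` -/
  | shr (dst a b : Fin k)
  /-- `dst := A[a]` -/
  | load (dst a : Fin k)
  /-- `A[a] := b` -/
  | store (a b : Fin k)
  /-- unconditional jump -/
  | jump (target : ℕ)
  /-- jump if `a < b` -/
  | jumpLt (a b : Fin k) (target : ℕ)
  /-- jump if `a = b` -/
  | jumpEq (a b : Fin k) (target : ℕ)
  /-- call the user-defined function `preprocess` on the content of `a` -/
  | preprocess (a : Fin k)
  /-- call the user-defined function `postprocess` on the content of `a` -/
  | postprocess (a : Fin k)
  /-- stop -/
  | halt

/-- A program: a fixed number of registers and a finite list of instructions. -/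
structure Program where
  /-- the number of words of working memory -/
  numRegs : ℕ
  /-- the instructions -/
  code : List (Instr numRegs)

/-- A call of one of the two user-defined functions. -/
inductive Call where
  | pre (v : ℕ)
  | post (v : ℕ)

/-- A configuration. The user-defined functions work on memory of their own, and so they enter a
computation only through the list `calls` of the calls made so far, in chronological order. -/
structure Config (k : ℕ) where
  /-- program counter -/
  pc : ℕ
  /-- working memory -/
  reg : Fin k → ℕ
  /-- input memory -/
  mem : List ℕ
  /-- calls made so far -/
  calls : List Call

namespace Config

variable {k : ℕ}

/-- Go on to the next instruction. -/
def next (c : Config k) : Config k := { c with pc := c.pc + 1 }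

/-- Write the word `x` modulo `2 ^ w` into the register `r`, and go on. -/
def set (w : ℕ) (c : Config k) (r : Fin k) (x : ℕ) : Config k :=
  { c.next with reg := Function.update c.reg r (x % 2 ^ w) }

/-- Execute one instruction with word size `w`. The result is `none` after `halt`, and for a memory
access outside of the input memory, which is thereby ruled out in a computation that goes on. -/
def exec (w : ℕ) (c : Config k) : Instr k → Option (Config k)
  | .const d x => some (c.set w d x)
  | .copy d a => some (c.set w d (c.reg a))
  | .add d a b => some (c.set w d (c.reg a + c.reg b))
  | .sub d a b => some (c.set w d (c.reg a + 2 ^ w - c.reg b))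
  | .mul d a b => some (c.set w d (c.reg a * c.reg b))
  | .shl d a b => some (c.set w d (c.reg a * 2 ^ c.reg b))
  | .shr d a b => some (c.set w d (c.reg a / 2 ^ c.reg b))
  | .load d a => (c.mem[c.reg a]?).map fun x => c.set w d x
  | .store a b =>
      if c.reg a < c.mem.length then
        some { c.next with mem := c.mem.set (c.reg a) (c.reg b) }
      else none
  | .jump t => some { c with pc := t }
  | .jumpLt a b t => some (if c.reg a < c.reg b then { c with pc := t } else c.next)
  | .jumpEq a b t => some (if c.reg a = c.reg b then { c with pc := t } else c.next)
  | .preprocess a => some { c.next with calls := c.calls ++ [.pre (c.reg a)] }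
  | .postprocess a => some { c.next with calls := c.calls ++ [.post (c.reg a)] }
  | .halt => none

end Config

namespace Program

/-- One step of the program (every instruction has unit cost). -/
def step (P : Program) (w : ℕ) (c : Config P.numRegs) : Option (Config P.numRegs) :=
  (P.code[c.pc]?).bind (c.exec w)

/-- `P.Reaches w t c c'`: with word size `w`, the program gets from `c` to `c'` in exactly `t`
steps. -/
inductive Reaches (P : Program) (w : ℕ) : ℕ → Config P.numRegs → Config P.numRegs → Prop
  | refl (c) : Reaches P w 0 c c
  | tail {t c₁ c₂ c₃} : Reaches P w t c₁ c₂ → P.step w c₂ = some c₃ → Reaches P w (t + 1) c₁ c₃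

/-- The initial configuration: the input memory is `A`, register `0` holds the argument `s`, and all
other registers hold `0`. -/
def init (P : Program) (A : List ℕ) (s : ℕ) : Config P.numRegs where
  pc := 0
  reg i := if i.val = 0 then s else 0
  mem := A
  calls := []

/-- With word size `w`, on input memory `A` and argument `s`, the program arrives within `bound`
steps at a `halt` instruction, it has then made exactly the calls `τ` of the user-defined functions
(in this order), and the input memory has its original content `A` again. -/
def RestoresAndCalls (P : Program) (w : ℕ) (A : List ℕ) (s bound : ℕ) (τ : List Call) : Prop :=
  ∃ t ≤ bound, ∃ c, P.Reaches w t (P.init A s) c ∧ P.code[c.pc]? = some .halt ∧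
    c.mem = A ∧ c.calls = τ

end Program

/-! ### Graphs and the sorted standard representation -/

section Graph

variable {n : ℕ}

/-- The name of a vertex: the vertex set is `{1, …, n}`. -/
def name (v : Fin n) : ℕ := v.val + 1

open Classical in
/-- The adjacency array of `u`: its out-neighbours in ascending order. -/
noncomputable def adjArray (G : Digraph (Fin n)) (u : Fin n) : List (Fin n) :=
  (List.finRange n).filter fun v => G.Adj u v

/-- The number of arcs. -/
noncomputable def numArcs (G : Digraph (Fin n)) : ℕ := {e : Fin n × Fin n | G.Adj e.1 e.2}.ncard

/-- The table entry of `v`: the position at which the adjacency array of `v` starts. -/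
noncomputable def beginPos (G : Digraph (Fin n)) (v : Fin n) : ℕ :=
  n + 2 + ∑ u ∈ Finset.Iio v, (adjArray G u).length

/-- The sorted standard representation: the number of vertices, the table of the begin positions of
the adjacency arrays, the total length of the adjacency arrays, and the adjacency arrays themselves
one after the other. -/
noncomputable def sortedRep (G : Digraph (Fin n)) : List ℕ :=
  n :: (List.finRange n).map (beginPos G) ++
    (∑ u, (adjArray G u).length) :: (List.finRange n).flatMap fun u => (adjArray G u).map name

/-- An undirected graph, seen as a digraph: every edge is stored at both of its endpoints. -/
def bidirected (G : SimpleGraph (Fin n)) : Digraph (Fin n) where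
  Adj := G.Adj

/-! ### Depth-first search -/

/-- `Explores G L W τ W'`: if `W` is the set of the vertices visited so far, then to go through the
list `L` and to visit, by depth-first search, every vertex of it that is white when its turn comes
may result in the calls `τ`, and `W'` is the set of the visited vertices afterwards. A visited
vertex may go through its out-neighbours in any order. -/
inductive Explores (G : Digraph (Fin n)) :
    List (Fin n) → Finset (Fin n) → List Call → Finset (Fin n) → Prop
  | nil (W) : Explores G [] W [] W
  | skip {v L W τ W'} : v ∈ W → Explores G L W τ W' → Explores G (v :: L) W τ W'
  | visit {v L W N τ₁ W₁ τ₂ W₂} : v ∉ W → N.Nodup → (∀ x, x ∈ N ↔ G.Adj v x) →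
      Explores G N (insert v W) τ₁ W₁ → Explores G L W₁ τ₂ W₂ →
      Explores G (v :: L) W (.pre (name v) :: τ₁ ++ .post (name v) :: τ₂) W₂

/-- `τ` is the sequence of the calls of a depth-first search that starts at `s` and visits the
vertices reachable from `s`. -/
def IsDFSFrom (G : Digraph (Fin n)) (s : Fin n) (τ : List Call) : Prop :=
  ∃ W, Explores G [s] ∅ τ W

/-- `τ` is the sequence of the calls of a depth-first search that starts at `s` and is started again
at a white vertex as long as there is one, so that all vertices are visited. -/
def IsDFSForest (G : Digraph (Fin n)) (s : Fin n) (τ : List Call) : Prop :=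
  ∃ R W, (s :: R).Nodup ∧ (∀ v, v ∈ s :: R) ∧ Explores G (s :: R) ∅ τ W

end Graph

end InPlaceDFS

open InPlaceDFS

/-!
A depth-first search needs, for every gray vertex, the way back to its parent, the position in its
list at which it is to be continued, and the colour, and here there is no room for any of this but
in the input itself. The program therefore works in three phases, and it is the same program for
both kinds of search but for one jump.

*Rearrangement.* The lists of length 1 are moved in front of all others, the longer ones keep
their order, and the last two entries of every longer list are exchanged. As the lists are
strictly ascending, the only descent in a longer list is then at its end (`swapLast_descent`), so
that the end of a list can be recognized without looking at the table, and a comparison of the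
position with the boundary `bnd` tells whether the list has length 1. The table entry of a vertex
without out-neighbours becomes the length of the input. All table entries are now at least
`n + 2`, and smaller values of the table are free for the use of the search (`Pass2`, `Layout`).

*Search.* A vertex is white as long as its table entry is at least `n + 2`. When the search visits
`y`, coming from the slot `r` in the list of the parent `u`, it stores `u` in the table entry of
`y` and `r` in the first word of the list of `y`. The first entry of that list, which is thereby
displaced, is held by a register; when the search descends from another slot of the list, it
leaves the first entry in that slot, and the entry of the slot itself is known again when the
search comes back, since it comes back from just this vertex. Since slots exceed `n` and entries
do not, the first word of a list can be found from its end by a scan to the left. When `y` is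
finished, its list is repaired, and its table entry becomes the minimum of 2 and its number of
out-neighbours. So the effect of a visit on the memory is only that the vertices visited are
marked as black (`Painted`), and `visitsUpTo` proves this, together with the amortized number of
steps, by induction on the number of white vertices.

*Restoration.* After the search every list is in its place and the table entry of each vertex
tells whether its list is empty, of length 1, or longer. One pass takes the lists of length 1 back
into the table, and another one moves all lists to their original places, finding the ends of the
longer lists by their descents, and computes the table anew (`steps_restore`). As the input is
determined by the lists (`IsInput.eq_rep`), the memory is the original one.

The word RAM is treated by symbolic execution: `Steps E k c c'` says that at most `k` steps lead
from `c` to `c'`, where the memory is a function and all words occurring are at most the length of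
the input, so that arithmetic modulo `2 ^ w` plays no role.
-/

namespace InPlaceDFS

/-! ### The program and its registers -/

/-- The contents of the fourteen registers, by name. Below, they are written with the
anonymous constructor, and so in this order. -/
structure Regs where
  /-- the current vertex -/
  cur : ℕ
  /-- the number of vertices -/
  n : ℕ
  /-- the length of the input -/
  len : ℕ
  /-- where the lists of length at least 2 begin -/
  bnd : ℕ
  /-- the number of vertices plus one, also the mark of the root -/
  succ : ℕ
  /-- the constant one -/
  one : ℕ
  /-- the parent of the current vertex -/
  par : ℕ
  /-- the slot in the list of the parent to which the search returns -/
  ret : ℕ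
  /-- the current slot, a position in the input memory -/
  slot : ℕ
  /-- the first entry of the list of the current vertex -/
  fst : ℕ
  /-- the out-neighbour under consideration -/
  chd : ℕ
  /-- scratch -/
  t : ℕ
  /-- scratch -/
  x : ℕ
  /-- loop counter -/
  i : ℕ

/-- The number of the register `cur`. The other registers are numbered in the order of the fields of
`Regs`. -/
abbrev rCur : Fin 14 := 0
abbrev rN : Fin 14 := 1
abbrev rLen : Fin 14 := 2
abbrev rBnd : Fin 14 := 3
abbrev rSucc : Fin 14 := 4
abbrev rOne : Fin 14 := 5
abbrev rPar : Fin 14 := 6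
abbrev rRet : Fin 14 := 7
abbrev rSlot : Fin 14 := 8
abbrev rFst : Fin 14 := 9
abbrev rChd : Fin 14 := 10
abbrev rT : Fin 14 := 11
abbrev rX : Fin 14 := 12
abbrev rI : Fin 14 := 13

/-- The content of a register. -/
def Regs.get (R : Regs) (r : Fin 14) : ℕ :=
  match r.val with
  | 0 => R.cur | 1 => R.n | 2 => R.len | 3 => R.bnd | 4 => R.succ | 5 => R.one | 6 => R.par
  | 7 => R.ret | 8 => R.slot | 9 => R.fst | 10 => R.chd | 11 => R.t | 12 => R.x | _ => R.i

/-- Write into a register. -/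
def Regs.set (R : Regs) (r : Fin 14) (v : ℕ) : Regs :=
  match r.val with
  | 0 => { R with cur := v } | 1 => { R with n := v } | 2 => { R with len := v }
  | 3 => { R with bnd := v } | 4 => { R with succ := v } | 5 => { R with one := v }
  | 6 => { R with par := v } | 7 => { R with ret := v } | 8 => { R with slot := v }
  | 9 => { R with fst := v } | 10 => { R with chd := v } | 11 => { R with t := v }
  | 12 => { R with x := v } | _ => { R with i := v }

theorem Regs.get_set (R : Regs) (r : Fin 14) (v : ℕ) :
    (R.set r v).get = Function.update R.get r v := by
  funext q
  fin_cases r <;> fin_cases q <;> rfl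

/-- The program. With `full` it performs a full depth-first search. A comment gives the address
of the instruction that follows it; the lemmas about parts of the program refer to these
addresses.

In the search, the register `cur` holds the gray vertex at which the search is. Its table entry
is its parent, and the first word of its list is the slot to which the search returns when `cur`
is finished; only this word of the list exceeds `n`. The first entry of the list, which it
displaces, is held by `fst`. While the search is below the first entry, that entry is stored
nowhere, but it is the vertex from which the search comes back. While the search is below the
entry of another slot, this slot holds the first entry, and its own entry is the vertex from
which the search comes back. -/
def code (full : Bool) : List (Instr 14) := [
  -- 0: constants: `n`, `n + 1`, and the length of the input (the register `t` still holds 0)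
  .const rOne 1, .load rN rT, .add rSucc rN rOne, .load rLen rSucc, .add rLen rLen rSucc,
  .add rLen rLen rOne, .copy rBnd rLen, .copy rSlot rLen, .copy rI rN,
  -- 9: pass 1, vertices in descending order: lists of length at least 2 move to the right
  -- (`chd` still holds 0; `par` is where the list of `i` starts, `slot` is where it ends)
  .jumpEq rI rChd 37, .load rPar rI, .jumpEq rPar rSlot 34, .add rT rPar rOne,
  .jumpEq rT rSlot 30, .sub rSlot rSlot rOne, .load rT rSlot, .sub rSlot rSlot rOne,
  .load rX rSlot, .sub rBnd rBnd rOne, .store rBnd rX, .sub rBnd rBnd rOne, .store rBnd rT,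
  .jumpEq rPar rSlot 28, .sub rSlot rSlot rOne, .load rT rSlot, .sub rBnd rBnd rOne,
  .store rBnd rT, .jump 22, .store rI rBnd, .jump 35, .load rX rPar, .store rI rX,
  .copy rSlot rPar, .jump 35, .store rI rLen, .sub rI rI rOne, .jump 9,
  -- 37: pass 2: the lists of length 1 go in front of the others
  .add rSlot rSucc rOne, .add rI rI rOne, .jumpLt rN rI 46, .load rT rI, .jumpLt rN rT 38,
  .store rSlot rT, .store rI rSlot, .add rSlot rSlot rOne, .jump 38,
  -- 46: start of the search
  .const rI 0, .copy rPar rSucc, .copy rRet rSucc,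
  -- 49: visit the white vertex `cur`
  .preprocess rCur, .load rT rCur, .jumpEq rT rLen 97, .store rCur rPar, .copy rSlot rT,
  .load rFst rSlot, .store rSlot rRet, .load rX rFst, .jumpLt rSucc rX 71,
  -- 58: the first entry of the list is done
  .jumpLt rSlot rBnd 86, .add rSlot rSlot rOne,
  -- 60: look at the entry in `slot`
  .load rChd rSlot, .load rT rChd, .jumpLt rSucc rT 75,
  -- 63: is `slot` the last one of its list?
  .sub rT rSlot rOne, .load rX rT, .jumpLt rN rX 69, .jumpLt rChd rX 80, .add rSlot rSlot rOne,
  .jump 60, .copy rX rFst, .jump 66,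
  -- 71: descend to a white out-neighbour
  .copy rPar rCur, .copy rRet rSlot, .copy rCur rFst, .jump 49, .store rSlot rFst,
  .copy rPar rCur, .copy rRet rSlot, .copy rCur rChd, .jump 49,
  -- 80: finish `cur`: find the head of its list, repair it, colour `cur` black
  .load rX rT, .jumpLt rN rX 84, .sub rT rT rOne, .jump 80, .const rChd 2, .jump 89,
  .copy rT rSlot, .load rX rSlot, .const rChd 1, .store rT rFst, .load rPar rCur,
  .store rCur rChd, .postprocess rCur, .copy rChd rCur, .copy rCur rPar, .copy rSlot rX,
  .jump 103,
  -- 97: visit a vertex without out-neighbours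
  .const rT 0, .store rCur rT, .postprocess rCur, .copy rChd rCur, .copy rCur rPar,
  .copy rSlot rRet,
  -- 103: return to the vertex `cur` in whose list `slot` is the entry `chd` just visited
  .jumpEq rSlot rSucc 111, .load rX rSlot, .jumpLt rN rX 109, .copy rFst rX, .store rSlot rChd,
  .jump 63, .copy rFst rChd, .jump 58,
  -- 111: the search from one start vertex is over
  .jump (cond full 112 119), .add rI rI rOne, .jumpLt rN rI 119, .load rT rI,
  .jumpLt rSucc rT 117, .jump 111, .copy rCur rI, .jump 47,
  -- 119: restoration, pass 1: the lists of length 1 go back to the table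
  .const rI 0, .const rPar 0, .const rChd 2, .add rSlot rSucc rOne, .add rI rI rOne,
  .jumpLt rN rI 138, .load rT rI, .jumpEq rT rLen 132, .jumpEq rT rPar 132, .jumpEq rT rChd 130,
  .jumpLt rT rBnd 134, .store rI rSucc, .jump 123, .store rI rLen, .jump 123, .load rX rSlot,
  .store rI rX, .add rSlot rSlot rOne, .jump 123,
  -- 138: restoration, pass 2: all lists go back to their places
  .const rI 0, .add rSlot rSucc rOne, .add rI rI rOne, .jumpLt rN rI 162, .load rT rI,
  .store rI rSlot, .jumpEq rT rLen 140, .jumpEq rT rSucc 149, .store rSlot rT,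
  .add rSlot rSlot rOne, .jump 140, .load rX rBnd, .add rBnd rBnd rOne, .load rT rBnd,
  .jumpLt rT rX 156, .store rSlot rX, .add rSlot rSlot rOne, .jump 149, .store rSlot rT,
  .add rSlot rSlot rOne, .store rSlot rX, .add rSlot rSlot rOne, .add rBnd rBnd rOne, .jump 140,
  .halt]

/-- The program as an object of the machine model. -/
def prog (full : Bool) : Program := ⟨14, code full⟩

/-! ### Symbolic execution -/

/-- A configuration in which the memory is a function, to be read on an initial segment only. -/
structure St where
  /-- program counter -/
  pc : ℕ
  /-- registers -/
  R : Regs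
  /-- input memory -/
  M : ℕ → ℕ
  /-- calls made so far -/
  calls : List Call

/-- The configuration that a symbolic one stands for, with an input memory of `N` words. -/
def St.conf (N : ℕ) (c : St) : Config 14 := ⟨c.pc, c.R.get, (List.range N).map c.M, c.calls⟩

/-- The parameters of a computation: which program, the length of the input, and the word size. -/
structure Env where
  /-- whether the search is a full one -/
  full : Bool
  /-- the length of the input -/
  N : ℕ
  /-- the word size -/
  w : ℕ
  hw : N < 2 ^ w

/-- With at most `k` steps, the program gets from `c` to `c'`. -/
def Steps (E : Env) (k : ℕ) (c c' : St) : Prop :=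
  ∃ t ≤ k, (prog E.full).Reaches E.w t (c.conf E.N) (c'.conf E.N)

theorem reaches_trans {P : Program} {w s t : ℕ} {a b c : Config P.numRegs}
    (h₁ : P.Reaches w s a b) (h₂ : P.Reaches w t b c) : P.Reaches w (s + t) a c := by
  induction h₂ with
  | refl => exact h₁
  | tail _ h ih => exact .tail (ih h₁) h

/- In the rules for the single instructions, the words that are written are required to be at most
`E.N`, so that no computation modulo `2 ^ E.w` takes place. -/

namespace Steps

variable {E : Env} {k l : ℕ} {a b c : St}

theorem refl (c : St) : Steps E 0 c c := ⟨0, le_rfl, .refl _⟩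

theorem trans (h₁ : Steps E k a b) (h₂ : Steps E l b c) : Steps E (k + l) a c := by
  obtain ⟨s, hs, h₁⟩ := h₁
  obtain ⟨t, ht, h₂⟩ := h₂
  exact ⟨s + t, by omega, reaches_trans h₁ h₂⟩

theorem mono (h : Steps E k a b) (hk : k ≤ l) : Steps E l a b := by
  obtain ⟨s, hs, h⟩ := h
  exact ⟨s, hs.trans hk, h⟩

variable {pc : ℕ} {R : Regs} {M : ℕ → ℕ} {τ : List Call} {d e f : Fin 14} {x : ℕ}

/-- One instruction, followed by a computation. -/
theorem head {I : Instr 14} (h : (code E.full)[pc]? = some I)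
    (hI : (St.conf E.N ⟨pc, R, M, τ⟩).exec E.w I = some (b.conf E.N)) (hb : Steps E k b c) :
    Steps E (k + 1) ⟨pc, R, M, τ⟩ c := by
  obtain ⟨t, ht, hb⟩ := hb
  refine ⟨1 + t, by omega, reaches_trans (.tail (.refl _) ?_) hb⟩
  change ((code E.full)[pc]?).bind _ = _
  rw [h]
  exact hI

theorem set_conf (hx : x ≤ E.N) : (St.conf E.N ⟨pc, R, M, τ⟩).set E.w d x =
    St.conf E.N ⟨pc + 1, R.set d x, M, τ⟩ := by
  simp [St.conf, Config.set, Config.next, Regs.get_set, Nat.mod_eq_of_lt (hx.trans_lt E.hw)]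

theorem const (h : (code E.full)[pc]? = some (.const d x)) (hx : x ≤ E.N)
    (hb : Steps E k ⟨pc + 1, R.set d x, M, τ⟩ c) : Steps E (k + 1) ⟨pc, R, M, τ⟩ c :=
  head h (congrArg some (set_conf hx)) hb

theorem copy (h : (code E.full)[pc]? = some (.copy d e)) (hx : R.get e ≤ E.N)
    (hb : Steps E k ⟨pc + 1, R.set d (R.get e), M, τ⟩ c) : Steps E (k + 1) ⟨pc, R, M, τ⟩ c :=
  head h (congrArg some (set_conf hx)) hb

theorem add (h : (code E.full)[pc]? = some (.add d e f)) (he : R.get e + R.get f = x)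
    (hx : x ≤ E.N) (hb : Steps E k ⟨pc + 1, R.set d x, M, τ⟩ c) :
    Steps E (k + 1) ⟨pc, R, M, τ⟩ c := by
  subst he
  exact head h (congrArg some (set_conf hx)) hb

theorem sub (h : (code E.full)[pc]? = some (.sub d e f)) (he : x + R.get f = R.get e)
    (hx : x ≤ E.N) (hb : Steps E k ⟨pc + 1, R.set d x, M, τ⟩ c) :
    Steps E (k + 1) ⟨pc, R, M, τ⟩ c := by
  refine head h (congrArg some ?_) hb
  rw [← set_conf hx]
  have hw := E.hw
  have : R.get e + 2 ^ E.w - R.get f = x + 2 ^ E.w := by omega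
  change Config.set _ _ _ (R.get e + 2 ^ E.w - R.get f) = _
  simp [Config.set, this]

theorem load (h : (code E.full)[pc]? = some (.load d e)) (he : R.get e < E.N)
    (hM : M (R.get e) = x) (hx : x ≤ E.N) (hb : Steps E k ⟨pc + 1, R.set d x, M, τ⟩ c) :
    Steps E (k + 1) ⟨pc, R, M, τ⟩ c := by
  refine head h ?_ hb
  change Option.map _ ((List.range E.N).map M)[R.get e]? = _
  rw [List.getElem?_map, List.getElem?_range he]
  exact congrArg some ((congrArg _ hM).trans (set_conf hx))

theorem store (h : (code E.full)[pc]? = some (.store d e)) (hd : R.get d < E.N)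
    (hb : Steps E k ⟨pc + 1, R, Function.update M (R.get d) (R.get e), τ⟩ c) :
    Steps E (k + 1) ⟨pc, R, M, τ⟩ c := by
  refine head h ?_ hb
  change (if R.get d < ((List.range E.N).map M).length then _ else _) = _
  rw [if_pos (by simpa using hd)]
  have : ((List.range E.N).map M).set (R.get d) (R.get e) =
      (List.range E.N).map (Function.update M (R.get d) (R.get e)) := by
    refine List.ext_getElem (by simp) fun i _ _ => ?_
    simp [List.getElem_set, Function.update_apply, eq_comm]
  simp [St.conf, Config.next, this]

theorem jump {t : ℕ} (h : (code E.full)[pc]? = some (.jump t))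
    (hb : Steps E k ⟨t, R, M, τ⟩ c) : Steps E (k + 1) ⟨pc, R, M, τ⟩ c :=
  head h rfl hb

theorem lt {t : ℕ} (h : (code E.full)[pc]? = some (.jumpLt d e t)) (hd : R.get d < R.get e)
    (hb : Steps E k ⟨t, R, M, τ⟩ c) : Steps E (k + 1) ⟨pc, R, M, τ⟩ c :=
  head (b := ⟨t, R, M, τ⟩) h (congrArg some (if_pos hd)) hb

theorem not_lt {t : ℕ} (h : (code E.full)[pc]? = some (.jumpLt d e t)) (hd : R.get e ≤ R.get d)
    (hb : Steps E k ⟨pc + 1, R, M, τ⟩ c) : Steps E (k + 1) ⟨pc, R, M, τ⟩ c :=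
  head (b := ⟨pc + 1, R, M, τ⟩) h (congrArg some (if_neg hd.not_gt)) hb

theorem eq {t : ℕ} (h : (code E.full)[pc]? = some (.jumpEq d e t)) (hd : R.get d = R.get e)
    (hb : Steps E k ⟨t, R, M, τ⟩ c) : Steps E (k + 1) ⟨pc, R, M, τ⟩ c :=
  head (b := ⟨t, R, M, τ⟩) h (congrArg some (if_pos hd)) hb

theorem ne {t : ℕ} (h : (code E.full)[pc]? = some (.jumpEq d e t)) (hd : R.get d ≠ R.get e)
    (hb : Steps E k ⟨pc + 1, R, M, τ⟩ c) : Steps E (k + 1) ⟨pc, R, M, τ⟩ c :=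
  head (b := ⟨pc + 1, R, M, τ⟩) h (congrArg some (if_neg hd)) hb

theorem pre (h : (code E.full)[pc]? = some (.preprocess d))
    (hb : Steps E k ⟨pc + 1, R, M, τ ++ [.pre (R.get d)]⟩ c) : Steps E (k + 1) ⟨pc, R, M, τ⟩ c :=
  head h rfl hb

theorem post (h : (code E.full)[pc]? = some (.postprocess d))
    (hb : Steps E k ⟨pc + 1, R, M, τ ++ [.post (R.get d)]⟩ c) : Steps E (k + 1) ⟨pc, R, M, τ⟩ c :=
  head h rfl hb

end Steps

/-! ### Explorations -/

section Explores

variable {n : ℕ} {G : Digraph (Fin n)}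

theorem Explores.append {L L' : List (Fin n)} {W W₁ W₂ : Finset (Fin n)} {τ τ' : List Call}
    (h : Explores G L W τ W₁) (h' : Explores G L' W₁ τ' W₂) :
    Explores G (L ++ L') W (τ ++ τ') W₂ := by
  induction h with
  | nil => exact h'
  | skip hv _ ih => exact .skip hv (ih h')
  | visit hv hN hx h₁ _ _ ih =>
    have := Explores.visit hv hN hx h₁ (ih h')
    simpa using this

theorem Explores.subset {L : List (Fin n)} {W W' : Finset (Fin n)} {τ : List Call}
    (h : Explores G L W τ W') : W ⊆ W' := by
  induction h with
  | nil => rfl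
  | skip _ _ ih => exact ih
  | visit _ _ _ _ _ ih₁ ih₂ => exact (Finset.subset_insert _ _).trans (ih₁.trans ih₂)

/-- A vertex that is visited already may be deleted from the list to be explored. -/
theorem Explores.filter_ne {L : List (Fin n)} {W W' : Finset (Fin n)} {τ : List Call}
    (h : Explores G L W τ W') {a : Fin n} (ha : a ∈ W) :
    Explores G (L.filter (· ≠ a)) W τ W' := by
  -- only the list at the root of the derivation is filtered, hence the second induction hypothesis
  induction h with
  | nil => exact .nil _
  | @skip v L W τ W' hv _ ih =>
    by_cases hva : v = a
    · simpa [hva] using ih ha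
    · simpa [hva] using Explores.skip hv (by simpa using ih ha)
  | @visit v L W N τ₁ W₁ τ₂ W₂ hv hN hx h₁ _ _ ih =>
    have hva : v ≠ a := fun h => hv (h ▸ ha)
    have := ih (h₁.subset (Finset.mem_insert_of_mem ha))
    simpa [hva] using Explores.visit hv hN hx h₁ (by simpa using this)

end Explores

/-! ### The memory during the search -/

theorem name_le {n : ℕ} (v : Fin n) : name v ≤ n := v.2

theorem name_pos {n : ℕ} (v : Fin n) : 0 < name v := Nat.succ_pos _

theorem name_inj {n : ℕ} {u v : Fin n} : name u = name v ↔ u = v := by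
  simp [name, Fin.ext_iff]

/-- The layout of the memory during the search. The list `out v` begins at the position `pos v`, the
lists of length 1 precede the position `B`, those of length at least 2 do not. The latter are
self-delimiting: the last entry is the first one that is smaller than its predecessor. -/
structure Layout {n : ℕ} (N B : ℕ) (pos : Fin n → ℕ) (out : Fin n → List (Fin n)) : Prop where
  le_bnd : n + 2 ≤ B
  bnd_le : B ≤ N
  le_pos : ∀ v, n + 2 ≤ pos v
  pos_add_le : ∀ v, pos v + (out v).length ≤ N
  pos_eq : ∀ v, (out v).length = 0 → pos v = N
  pos_lt_bnd : ∀ v, (out v).length = 1 → pos v < B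
  bnd_le_pos : ∀ v, 2 ≤ (out v).length → B ≤ pos v
  disjoint : ∀ u v i j, u ≠ v → i < (out u).length → j < (out v).length → pos u + i ≠ pos v + j
  descent : ∀ v j (h : j + 1 < (out v).length), (out v)[j + 1] < (out v)[j] ↔
    j + 2 = (out v).length

section Memory

variable {n : ℕ} (pos : Fin n → ℕ) (out : Fin n → List (Fin n))

/-- The table entry and the list of `v` are as they are for a white vertex. -/
def Intact (M : ℕ → ℕ) (v : Fin n) : Prop :=
  M (name v) = pos v ∧ ∀ j (h : j < (out v).length), M (pos v + j) = name (out v)[j]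

/-- The memory when exactly the vertices in `W` have been visited, apart from the lists of these
vertices. -/
def Ok (W : Finset (Fin n)) (M : ℕ → ℕ) : Prop :=
  (∀ v ∉ W, Intact pos out M v) ∧ ∀ v ∈ W, M (name v) ≤ n + 1

/-- The mark of a black vertex, from which it can be seen whether it has no, one, or several
out-neighbours. -/
def mark (v : Fin n) : ℕ := min (out v).length 2

/-- The memory changes from `M` to `M'`, precisely in that the vertices in `W'` but not in `W` are
marked as black. -/
def Painted (M : ℕ → ℕ) (W W' : Finset (Fin n)) (M' : ℕ → ℕ) : Prop :=
  (∀ v ∈ W', v ∉ W → M' (name v) = mark out v) ∧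
    ∀ x, (∀ v ∈ W', v ∉ W → name v ≠ x) → M' x = M x

/-- The number of words that belong to the vertices in `W`. -/
def weight (W : Finset (Fin n)) : ℕ := ∑ v ∈ W, ((out v).length + 1)

theorem weight_insert {W : Finset (Fin n)} {y : Fin n} (hy : y ∉ W) :
    weight out (insert y W) = weight out W + (out y).length + 1 := by
  rw [weight, Finset.sum_insert hy, weight]; omega

variable {pos out} {M M' M'' : ℕ → ℕ} {W W' W'' : Finset (Fin n)}

theorem Painted.refl (M : ℕ → ℕ) (W : Finset (Fin n)) : Painted out M W W M :=
  ⟨fun _ h h' => absurd h h', fun _ _ => rfl⟩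

theorem Painted.eq_of_lt (h : Painted out M W W' M') {x : ℕ} (hx : n < x) : M' x = M x :=
  h.2 x fun v _ _ => by have := name_le v; omega

theorem Painted.eq_of_mem (h : Painted out M W W' M') {y : Fin n} (hy : y ∈ W) :
    M' (name y) = M (name y) :=
  h.2 _ fun _ _ hv e => hv (name_inj.1 e ▸ hy)

theorem Painted.trans (h : Painted out M W W' M') (h' : Painted out M' W' W'' M'') (hW : W ⊆ W')
    (hW' : W' ⊆ W'') : Painted out M W W'' M'' := by
  refine ⟨fun v hv hv' => ?_, fun x hx => ?_⟩
  · by_cases hvW : v ∈ W'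
    · rw [h'.eq_of_mem hvW, h.1 v hvW hv']
    · exact h'.1 v hv hvW
  · rw [h'.2 x fun _ hv hv' => hx _ hv fun e => hv' (hW e),
      h.2 x fun v hv hv' => hx v (hW' hv) hv']

theorem Painted.ok {N B : ℕ} (hL : Layout N B pos out) (h : Painted out M W W' M')
    (hM : Ok pos out W M) (hW : W ⊆ W') : Ok pos out W' M' := by
  refine ⟨fun v hv => ⟨?_, fun j hj => ?_⟩, fun v hv => ?_⟩
  · rw [h.2 _ fun u hu _ e => hv ((name_inj (v := v)).1 e ▸ hu), (hM.1 v fun e => hv (hW e)).1]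
  · rw [h.eq_of_lt (by have := hL.le_pos v; omega), (hM.1 v fun e => hv (hW e)).2]
  · by_cases hvW : v ∈ W
    · rw [h.eq_of_mem hvW]; exact hM.2 v hvW
    · rw [h.1 v hv hvW]
      have := v.2
      exact (min_le_right _ _).trans (by omega)

/-- Overwriting a word of the list of a visited vertex is harmless. -/
theorem Ok.update_list {N B : ℕ} (hL : Layout N B pos out) (hM : Ok pos out W M) {y : Fin n}
    (hy : y ∈ W) {j : ℕ} (hj : j < (out y).length) (a : ℕ) :
    Ok pos out W (Function.update M (pos y + j) a) := by
  have hp := hL.le_pos y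
  have hne (v : Fin n) : name v ≠ pos y + j := by have := name_le v; omega
  refine ⟨fun v hv => ⟨?_, fun i hi => ?_⟩, fun v hv => ?_⟩
  · rw [Function.update_of_ne (hne v), (hM.1 v hv).1]
  · rw [Function.update_of_ne, (hM.1 v hv).2]
    exact hL.disjoint v y i j (fun e => hv (e ▸ hy)) hi hj
  · rw [Function.update_of_ne (hne v)]; exact hM.2 v hv

/-- Colouring a vertex gray. -/
theorem Ok.update_table {N B : ℕ} (hL : Layout N B pos out) (hM : Ok pos out W M) (y : Fin n)
    {a : ℕ} (ha : a ≤ n + 1) : Ok pos out (insert y W) (Function.update M (name y) a) := by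
  refine ⟨fun v hv => ?_, fun v hv => ?_⟩
  · rw [Finset.mem_insert, not_or] at hv
    refine ⟨?_, fun i hi => ?_⟩
    · rw [Function.update_of_ne (fun e => hv.1 (name_inj.1 e)), (hM.1 v hv.2).1]
    · rw [Function.update_of_ne, (hM.1 v hv.2).2]
      have := hL.le_pos v
      have := name_le y
      omega
  · by_cases e : v = y
    · subst e; simpa using ha
    · rw [Function.update_of_ne (fun h => e (name_inj.1 h))]
      exact hM.2 v (Finset.mem_of_mem_insert_of_ne hv e)

end Memory

/-! ### The search -/

section Search

variable {E : Env} {n B : ℕ} {pos : Fin n → ℕ} {out : Fin n → List (Fin n)}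

/-- Finish the vertex `y` whose list begins at `p`: the first entry `f` of the list is put back, and
the mark `c` of `y` into the table. -/
theorem steps_finish {y : Fin n} {u r f p c a b d i : ℕ} {M : ℕ → ℕ}
    {τ : List Call} (hu : M (name y) = u) (hu' : u ≤ n + 1) (hp : n < p) (hp' : p < E.N)
    (hr : r ≤ E.N) :
    Steps E 8 ⟨89, ⟨name y, n, E.N, B, n + 1, 1, a, b, d, f, c, p, r, i⟩, M, τ⟩
      ⟨103, ⟨u, n, E.N, B, n + 1, 1, u, b, r, f, name y, p, r, i⟩,
        Function.update (Function.update M p f) (name y) c, τ ++ [.post (name y)]⟩ := by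
  have hy := name_le y
  have hyp : Function.update M p f (name y) = u := by
    rw [Function.update_of_ne (by omega), hu]
  exact .store rfl hp' <| .load rfl (show name y < E.N by omega) hyp (by omega) <|
    .store rfl (show name y < E.N by omega) <| .post rfl <|
    .copy rfl (show name y ≤ E.N by omega) <| .copy rfl (show u ≤ E.N by omega) <|
    .copy rfl hr <| .jump rfl <| .refl _

/-- Search the head of the list of `y` from right to left. It is the only word of the list that does
not hold the name of a vertex. -/
theorem steps_scan (hL : Layout E.N B pos out) {y : Fin n} {r a b d f c i x : ℕ} {M : ℕ → ℕ}
    {τ : List Call} (hr : n < r) (hr' : r ≤ E.N) (hp : M (pos y) = r) :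
    ∀ j, j < (out y).length →
      (∀ k, 1 ≤ k → k ≤ j → M (pos y + k) ≤ n) →
      ∃ k ≤ 4 * j + 4, Steps E k
        ⟨80, ⟨name y, n, E.N, B, n + 1, 1, a, b, d, f, c, pos y + j, x, i⟩, M, τ⟩
        ⟨89, ⟨name y, n, E.N, B, n + 1, 1, a, b, d, f, 2, pos y, r, i⟩, M, τ⟩ := by
  intro j hj hM
  have hlen := hL.pos_add_le y
  have hnp := hL.le_pos y
  have hy := y.2
  induction j generalizing x with
  | zero =>
    exact ⟨4, by omega, .load rfl (show pos y < E.N by omega) hp hr' <| .lt rfl hr <|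
      .const rfl (by omega) <| .jump rfl <| .refl _⟩
  | succ j ih =>
    obtain ⟨k, hk, h⟩ := ih (x := M (pos y + (j + 1))) (by omega)
      fun k h h' => hM k h (by omega)
    have hx := hM (j + 1) (by omega) le_rfl
    exact ⟨k + 4, by omega,
      .load rfl (show pos y + (j + 1) < E.N by omega) rfl
        (show M (pos y + (j + 1)) ≤ E.N by omega) <|
      .not_lt rfl hx <| .sub rfl (show pos y + j + 1 = pos y + (j + 1) by omega) (by omega) <|
      .jump rfl h⟩

/-- The test whether the slot `pos y + (j + 1)` is the last one of the list of `y`, if it is not. -/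
theorem steps_next (hL : Layout E.N B pos out) {y : Fin n} {r a b t x i j : ℕ} {M : ℕ → ℕ}
    {τ : List Call} (hr : n < r) (hr' : r ≤ E.N) (hp : M (pos y) = r)
    (hj : j + 2 < (out y).length)
    (hM : ∀ k (h : k < (out y).length), 1 ≤ k → M (pos y + k) = name (out y)[k]) :
    ∃ t' x', Steps E 8
      ⟨63, ⟨name y, n, E.N, B, n + 1, 1, a, b, pos y + (j + 1), name ((out y)[0]'(by omega)),
        name (out y)[j + 1], t, x, i⟩, M, τ⟩
      ⟨60, ⟨name y, n, E.N, B, n + 1, 1, a, b, pos y + (j + 2), name ((out y)[0]'(by omega)),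
        name (out y)[j + 1], t', x', i⟩, M, τ⟩ := by
  have hlen := hL.pos_add_le y
  have hle : name ((out y)[j]'(by omega)) ≤ name (out y)[j + 1] := by
    have := mt (hL.descent y j (by omega)).1 (by omega)
    simpa [name] using this
  have h0 := name_le ((out y)[0]'(by omega))
  have hn := hL.le_pos y
  -- for `j = 0` the predecessor is the first entry, which is not in its place but in `fst`
  rcases j with _ | j
  · exact ⟨_, _, .sub rfl (show pos y + 1 = pos y + (0 + 1) by omega) (by omega) <|
      .load rfl (show pos y < E.N by omega) hp hr' <| .lt rfl hr <|
      .copy rfl (by change name _ ≤ _; omega) <|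
      .jump rfl <| .not_lt rfl hle <| .add rfl rfl (show pos y + (0 + 1) + 1 ≤ E.N by omega) <|
      .jump rfl <| .refl _⟩
  · have hx := hM (j + 1) (by omega) (by omega)
    have := name_le ((out y)[j + 1]'(by omega))
    refine ⟨_, _, .mono (.sub rfl
        (show pos y + (j + 1) + 1 = pos y + (j + 1 + 1) by omega) (by omega) <|
      .load rfl (show pos y + (j + 1) < E.N by omega) hx (by omega) <| .not_lt rfl this <|
      .not_lt rfl hle <|
      .add rfl rfl (show pos y + (j + 1 + 1) + 1 ≤ E.N by omega) <|
      .jump rfl <| .refl _) (by omega)⟩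

/-- The test whether the slot `pos y + (j + 1)` is the last one of the list of `y`, if it is: the
vertex `y` is finished. -/
theorem steps_last (hL : Layout E.N B pos out) {y : Fin n} {u r a b t x i j : ℕ} {M : ℕ → ℕ}
    {τ : List Call} (hu : M (name y) = u) (hu' : u ≤ n + 1) (hr : n < r) (hr' : r ≤ E.N)
    (hp : M (pos y) = r) (hj : j + 2 = (out y).length)
    (hM : ∀ k (h : k < (out y).length), 1 ≤ k → M (pos y + k) = name (out y)[k]) :
    ∃ k ≤ 4 * (out y).length + 20, ∃ a' b' f' t' x', Steps E k
      ⟨63, ⟨name y, n, E.N, B, n + 1, 1, a, b, pos y + (j + 1), name ((out y)[0]'(by omega)),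
        name (out y)[j + 1], t, x, i⟩, M, τ⟩
      ⟨103, ⟨u, n, E.N, B, n + 1, 1, a', b', r, f', name y, t', x', i⟩,
        Function.update (Function.update M (pos y) (name ((out y)[0]'(by omega)))) (name y) 2,
        τ ++ [.post (name y)]⟩ := by
  have hlen := hL.pos_add_le y
  have hlt : name (out y)[j + 1] < name ((out y)[j]'(by omega)) := by
    have := (hL.descent y j (by omega)).2 (by omega)
    simpa [name] using this
  have h0 := name_le ((out y)[0]'(by omega))
  have hn := hL.le_pos y
  obtain ⟨k, hk, hs⟩ := steps_scan (E := E) (a := a) (b := b) (d := pos y + (j + 1))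
    (f := name ((out y)[0]'(by omega))) (c := name (out y)[j + 1]) (i := i) (τ := τ)
    (x := name ((out y)[j]'(by omega)))
    hL hr hr' hp j (by omega) fun k h h' => by
      rw [hM k (by omega) h]; exact name_le _
  have hf := hs.trans (steps_finish hu hu' (by omega) (by omega) hr')
  rcases j with _ | j
  · exact ⟨_, by omega, _, _, _, _, _, .sub rfl
        (show pos y + 1 = pos y + (0 + 1) by omega) (by omega) <|
      .load rfl (show pos y < E.N by omega) hp hr' <| .lt rfl hr <|
      .copy rfl (by change name _ ≤ _; omega) <|
      .jump rfl <| .lt rfl hlt hf⟩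
  · have hx := hM (j + 1) (by omega) (by omega)
    have := name_le ((out y)[j + 1]'(by omega))
    exact ⟨_, by omega, _, _, _, _, _, .sub rfl
        (show pos y + (j + 1) + 1 = pos y + (j + 1 + 1) by omega) (by omega) <|
      .load rfl (show pos y + (j + 1) < E.N by omega) hx (by omega) <| .not_lt rfl this <|
      .lt rfl hlt hf⟩

end Search

section Visit

variable {n : ℕ}

/-- If at most `k` vertices are white, then the program visits any white vertex `y` correctly: it
makes the calls of an exploration, it repairs the lists of the vertices that it visits, and the
number of steps is proportional to the number of words that belong to them. The search returns to
the slot `r` in the list of the parent `u`, or it ends if `u` and `r` are the mark `n + 1` of the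
root. The constant 60 is large enough for the scan of the list at its end, the work on the single
entries, and the vertex itself. -/
def VisitsUpTo (E : Env) (B : ℕ) (pos : Fin n → ℕ) (out : Fin n → List (Fin n))
    (G : Digraph (Fin n)) (k : ℕ) : Prop :=
  ∀ (W : Finset (Fin n)) (M : ℕ → ℕ) (y : Fin n) (u r s f v t x i : ℕ) (τ : List Call),
    Wᶜ.card ≤ k → y ∉ W → Ok pos out W M → u ≤ n + 1 → n < r → r ≤ E.N →
    ∃ W' τ' M' K a b f' t' x', insert y W ⊆ W' ∧ Explores G [y] W τ' W' ∧ Painted out M W W' M' ∧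
      K + 60 * weight out W ≤ 60 * weight out W' ∧
      Steps E K ⟨49, ⟨name y, n, E.N, B, n + 1, 1, u, r, s, f, v, t, x, i⟩, M, τ⟩
        ⟨103, ⟨u, n, E.N, B, n + 1, 1, a, b, r, f', name y, t', x', i⟩, M', τ ++ τ'⟩

variable {E : Env} {B : ℕ} {pos : Fin n → ℕ} {out : Fin n → List (Fin n)} {G : Digraph (Fin n)}

theorem card_compl_le {W W' : Finset (Fin n)} {k : ℕ} (h : W ⊆ W') (hW : Wᶜ.card ≤ k) :
    W'ᶜ.card ≤ k :=
  (Finset.card_le_card (Finset.compl_subset_compl.2 h)).trans hW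

/-- The program deals with the entry in the slot `pos y + (j + 1)`: it visits it if it is white. -/
theorem steps_entry (hL : Layout E.N B pos out) {k : ℕ} (hk : VisitsUpTo E B pos out G k)
    {y : Fin n} {i j : ℕ} (hj : j + 1 < (out y).length) {W : Finset (Fin n)} {M : ℕ → ℕ}
    {a b v t x : ℕ} {τ : List Call} (hW : Wᶜ.card ≤ k) (hy : y ∈ W) (hM : Ok pos out W M)
    (hMj : M (pos y + (j + 1)) = name (out y)[j + 1]) :
    ∃ W' τ' M' K a' b' t' x', W ⊆ W' ∧ Explores G [(out y)[j + 1]] W τ' W' ∧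
      Painted out M W W' M' ∧ K + 60 * weight out W ≤ 60 * weight out W' + 14 ∧
      Steps E K ⟨60, ⟨name y, n, E.N, B, n + 1, 1, a, b, pos y + (j + 1),
          name ((out y)[0]'(by omega)), v, t, x, i⟩, M, τ⟩
        ⟨63, ⟨name y, n, E.N, B, n + 1, 1, a', b', pos y + (j + 1), name ((out y)[0]'(by omega)),
          name (out y)[j + 1], t', x', i⟩, M', τ ++ τ'⟩ := by
  have hlen := hL.pos_add_le y
  have hp := hL.le_pos y
  have h0 := name_le ((out y)[0]'(by omega))
  have hyn := name_le y
  generalize ho : (out y)[0]'(by omega) = o at *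
  generalize he : (out y)[j + 1] = e at *
  have hen := name_le e
  by_cases heW : e ∈ W
  · have het := hM.2 e heW
    exact ⟨W, [], M, 3, _, _, _, _, subset_rfl, .skip heW (.nil _), .refl _ _, by omega,
      .load rfl (show pos y + (j + 1) < E.N by omega) hMj (by omega) <|
      .load rfl (show name e < E.N by omega) rfl (show M (name e) ≤ E.N by omega) <|
      .not_lt rfl het <| by rw [List.append_nil]; exact .refl _⟩
  · have het := (hM.1 e heW).1
    have hpe := hL.le_pos e
    have hpe' := hL.pos_add_le e
    obtain ⟨W', τ', M', K, a', b', f', t', x', h₁, h₂, h₃, h₄, h₅⟩ :=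
      hk W (Function.update M (pos y + (j + 1)) (name o)) e (name y) (pos y + (j + 1))
        (pos y + (j + 1)) (name o) (name e) (pos e) x i τ hW heW (hM.update_list hL hy hj _)
        (by omega) (by omega) (by omega)
    have hf : M' (pos y + (j + 1)) = name o := by
      rw [h₃.eq_of_lt (by omega), Function.update_self]
    refine ⟨W', τ', Function.update M' (pos y + (j + 1)) (name e), _, _, _, _, _,
      (Finset.subset_insert _ _).trans h₁, h₂, ⟨fun v hv hv' => ?_, fun z hz => ?_⟩, ?_,
      .load rfl (show pos y + (j + 1) < E.N by omega) hMj (by omega) <|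
      .load rfl (show name e < E.N by omega) het (by omega) <|
      .lt rfl (show n + 1 < pos e by omega) <|
      .store rfl (show pos y + (j + 1) < E.N by omega) <|
      .copy rfl (show name y ≤ E.N by omega) <|
      .copy rfl (show pos y + (j + 1) ≤ E.N by omega) <|
      .copy rfl (show name e ≤ E.N by omega) <| .jump rfl <| h₅.trans <|
      .ne rfl (show pos y + (j + 1) ≠ n + 1 by omega) <|
      .load rfl (show pos y + (j + 1) < E.N by omega) hf (by omega) <|
      .not_lt rfl h0 <| .copy rfl (show name o ≤ E.N by omega) <|
      .store rfl (show pos y + (j + 1) < E.N by omega) <| .jump rfl <| .refl _⟩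
    · rw [Function.update_of_ne (by have := name_le v; omega), h₃.1 v hv hv']
    · by_cases hzs : z = pos y + (j + 1)
      · rw [hzs, Function.update_self, hMj]
      · rw [Function.update_of_ne hzs, h₃.2 z hz, Function.update_of_ne hzs]
    · omega

/-- The program goes through the list of `y` from the slot `pos y + (j + 1)` on, and finishes
`y`. -/
theorem steps_list (hL : Layout E.N B pos out) {k : ℕ} (hk : VisitsUpTo E B pos out G k)
    {y : Fin n} {u r : ℕ} (hu : u ≤ n + 1) (hr : n < r) (hr' : r ≤ E.N) {i : ℕ} (m : ℕ) :
    ∀ (j : ℕ) (hj : j + 2 + m = (out y).length) (W : Finset (Fin n)) (M : ℕ → ℕ)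
      (a b v t x : ℕ) (τ : List Call),
      Wᶜ.card ≤ k → y ∈ W → Ok pos out W M → M (name y) = u → M (pos y) = r →
      (∀ k (h : k < (out y).length), 1 ≤ k → M (pos y + k) = name (out y)[k]) →
      ∃ W' τ' M' K a' b' f' t' x', W ⊆ W' ∧ Explores G ((out y).drop (j + 1)) W τ' W' ∧
        Painted out M W W' M' ∧
        K + 60 * weight out W ≤ 60 * weight out W' + 24 * m + 4 * (out y).length + 40 ∧
        Steps E K ⟨60, ⟨name y, n, E.N, B, n + 1, 1, a, b, pos y + (j + 1),
            name ((out y)[0]'(by omega)), v, t, x, i⟩, M, τ⟩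
          ⟨103, ⟨u, n, E.N, B, n + 1, 1, a', b', r, f', name y, t', x', i⟩,
            Function.update (Function.update M' (pos y) (name ((out y)[0]'(by omega)))) (name y) 2,
            τ ++ τ' ++ [.post (name y)]⟩ := by
  have hyn := name_le y
  have hp := hL.le_pos y
  induction m with
  | zero =>
    intro j hj W M a b v t x τ hW hy hM hMu hMr hMl
    obtain ⟨W', τ', M', K, a', b', t', x', h₁, h₂, h₃, h₄, h₅⟩ :=
      steps_entry (a := a) (b := b) (v := v) (t := t) (x := x) (i := i) (τ := τ) hL hk
        (by omega : j + 1 < (out y).length) hW hy hM (hMl _ _ (by omega))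
    obtain ⟨K', hK', a'', b'', f', t'', x'', h⟩ :=
      steps_last (a := a') (b := b') (t := t') (x := x') (i := i) (τ := τ ++ τ') hL
        ((h₃.eq_of_mem hy).trans hMu) hu hr hr' ((h₃.eq_of_lt (by omega)).trans hMr) hj
        fun k h h' => (h₃.eq_of_lt (by omega)).trans (hMl k h h')
    refine ⟨W', τ', M', K + K', _, _, _, _, _, h₁, ?_, h₃, by omega, h₅.trans h⟩
    rwa [List.drop_eq_getElem_cons (by omega), List.drop_eq_nil_of_le (by omega)]
  | succ m ih =>
    intro j hj W M a b v t x τ hW hy hM hMu hMr hMl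
    obtain ⟨W', τ', M', K, a', b', t', x', h₁, h₂, h₃, h₄, h₅⟩ :=
      steps_entry (a := a) (b := b) (v := v) (t := t) (x := x) (i := i) (τ := τ) hL hk
        (by omega : j + 1 < (out y).length) hW hy hM (hMl _ _ (by omega))
    have hMr' := (h₃.eq_of_lt (by omega)).trans hMr
    have hMl' : ∀ k (h : k < (out y).length), 1 ≤ k → M' (pos y + k) = name (out y)[k] :=
      fun k h h' => (h₃.eq_of_lt (by omega)).trans (hMl k h h')
    obtain ⟨t'', x'', h⟩ := steps_next (a := a') (b := b') (t := t') (x := x') (i := i)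
      (τ := τ ++ τ') hL hr hr' hMr' (by omega : j + 2 < (out y).length) hMl'
    obtain ⟨W'', τ'', M'', K', a'', b'', f'', t₃, x₃, g₁, g₂, g₃, g₄, g₅⟩ :=
      ih (j + 1) (by omega) W' M' a' b' _ t'' x'' (τ ++ τ') (card_compl_le h₁ hW) (h₁ hy)
        (h₃.ok hL hM h₁) ((h₃.eq_of_mem hy).trans hMu) hMr' hMl'
    refine ⟨W'', τ' ++ τ'', M'', K + (8 + K'), _, _, _, _, _, h₁.trans g₁, ?_,
      h₃.trans g₃ h₁ g₁, by omega, h₅.trans (h.trans (by simpa using g₅))⟩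
    rw [List.drop_eq_getElem_cons (by omega)]
    exact h₂.append g₂

/-- The search is correct, by induction on the number of white vertices. -/
theorem visitsUpTo (hL : Layout E.N B pos out)
    (hG : ∀ v, (out v).Nodup ∧ ∀ x, x ∈ out v ↔ G.Adj v x) (k : ℕ) :
    VisitsUpTo E B pos out G k := by
  induction k with
  | zero =>
    intro W M y u r s f v t x i τ hW hy
    exact absurd (Finset.card_pos.2 ⟨y, Finset.mem_compl.2 hy⟩) (by omega)
  | succ k ih =>
    intro W M y u r s f v t x i τ hW hy hM hu hr hr'
    have hyn := name_le y
    have hlen := hL.pos_add_le y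
    have hp := hL.le_pos y
    have hyM := hM.1 y hy
    have hB := hL.bnd_le
    have hB' := hL.le_bnd
    have hcard : (insert y W)ᶜ.card ≤ k := by
      have h := Finset.card_erase_of_mem (Finset.mem_compl.2 hy)
      rw [← Finset.compl_insert] at h
      omega
    have hwt := weight_insert out hy
    rcases Nat.eq_zero_or_pos (out y).length with h0 | h0
    · -- no out-neighbours
      have hpN := hL.pos_eq y h0
      have hnil : out y = [] := List.length_eq_zero_iff.1 h0
      have hτ : τ ++ [.pre (name y), .post (name y)] =
          τ ++ [.pre (name y)] ++ [.post (name y)] := by simp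
      refine ⟨insert y W, [.pre (name y), .post (name y)], Function.update M (name y) 0, 9, _, _, _,
        _, _, subset_rfl, ?_, ⟨fun v hv hv' => ?_, fun z hz => ?_⟩, by omega,
        by rw [hτ]; exact .pre rfl <|
          .load rfl (show name y < E.N by omega) (hyM.1.trans hpN) le_rfl <|
          .eq rfl rfl <| .const rfl (by omega) <| .store rfl (show name y < E.N by omega) <|
          .post rfl <| .copy rfl (show name y ≤ E.N by omega) <|
          .copy rfl (show u ≤ E.N by omega) <| .copy rfl (show r ≤ E.N by omega) <| .refl _⟩
      · exact .visit (N := out y) (τ₁ := []) hy (hG y).1 (hG y).2 (hnil ▸ .nil _) (.nil _)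
      · obtain rfl : v = y := (Finset.mem_insert.1 hv).resolve_right hv'
        simp [mark, h0]
      · exact Function.update_of_ne (Ne.symm (hz y (Finset.mem_insert_self _ _) hy)) _ _
    · generalize hM₁ : Function.update (Function.update M (name y) u) (pos y) r = M₁
      have hf : M (pos y) = name (out y)[0] := hyM.2 0 h0
      have hok : Ok pos out (insert y W) M₁ := by
        have := (hM.update_table hL y hu).update_list hL (Finset.mem_insert_self y W) h0 r
        rwa [add_zero, hM₁] at this
      have hM₁y : M₁ (name y) = u := by
        rw [← hM₁, Function.update_of_ne (by omega), Function.update_self]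
      have hM₁p : M₁ (pos y) = r := by rw [← hM₁, Function.update_self]
      have hM₁l : ∀ k (h : k < (out y).length), 1 ≤ k → M₁ (pos y + k) = name (out y)[k] :=
        fun k h h' => by
          rw [← hM₁, Function.update_of_ne (by omega), Function.update_of_ne (by omega), hyM.2]
      -- the first entry of the list
      obtain ⟨W₁, τ₁, M₂, K, a, b, v', t', x', hW₁, hE₁, hP₁, hK, hs₁⟩ : ∃ W₁ τ₁ M₂ K a b v' t' x',
          insert y W ⊆ W₁ ∧ Explores G [(out y)[0]] (insert y W) τ₁ W₁ ∧
          Painted out M₁ (insert y W) W₁ M₂ ∧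
          K + 60 * weight out (insert y W) ≤ 60 * weight out W₁ + 18 ∧
          Steps E K ⟨49, ⟨name y, n, E.N, B, n + 1, 1, u, r, s, f, v, t, x, i⟩, M, τ⟩
            ⟨58, ⟨name y, n, E.N, B, n + 1, 1, a, b, pos y, name (out y)[0], v', t', x', i⟩, M₂,
              τ ++ [.pre (name y)] ++ τ₁⟩ := by
        generalize he : (out y)[0] = e at *
        have hen := name_le e
        have hf' : Function.update M (name y) u (pos y) = name e := by
          rw [Function.update_of_ne (by omega), hf]
        have hhead {K : ℕ} {c : St} (h : Steps E K
            ⟨57, ⟨name y, n, E.N, B, n + 1, 1, u, r, pos y, name e, v, pos y, M₁ (name e), i⟩,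
              M₁, τ ++ [.pre (name y)]⟩ c) (hx : M₁ (name e) ≤ E.N) : Steps E (K + 8)
              ⟨49, ⟨name y, n, E.N, B, n + 1, 1, u, r, s, f, v, t, x, i⟩, M, τ⟩ c := by
          subst hM₁
          exact .pre rfl <| .load rfl (show name y < E.N by omega) hyM.1 (by omega) <|
            .ne rfl (show pos y ≠ E.N by omega) <| .store rfl (show name y < E.N by omega) <|
            .copy rfl (show pos y ≤ E.N by omega) <|
            .load rfl (show pos y < E.N by omega) hf' (by omega) <|
            .store rfl (show pos y < E.N by omega) <|
            .load rfl (show name e < E.N by omega) rfl hx h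
        by_cases heW : e ∈ insert y W
        · have het := hok.2 e heW
          have hs : Steps E 1
            ⟨57, ⟨name y, n, E.N, B, n + 1, 1, u, r, pos y, name e, v, pos y, M₁ (name e), i⟩,
              M₁, τ ++ [.pre (name y)]⟩
            ⟨58, ⟨name y, n, E.N, B, n + 1, 1, u, r, pos y, name e, v, pos y, M₁ (name e), i⟩,
              M₁, τ ++ [.pre (name y)]⟩ := .not_lt rfl het (.refl _)
          exact ⟨_, [], M₁, 9, _, _, _, _, _, subset_rfl, .skip heW (.nil _), .refl _ _, by omega,
            by rw [List.append_nil]; exact hhead hs (by omega)⟩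
        · have het := (hok.1 e heW).1
          have hpe := hL.le_pos e
          have hpe' := hL.pos_add_le e
          obtain ⟨W₁, τ₁, M₂, K, a, b, f', t', x', h₁, h₂, h₃, h₄, h₅⟩ :=
            ih (insert y W) M₁ e (name y) (pos y) (pos y) (name e) v (pos y) (M₁ (name e)) i
              (τ ++ [.pre (name y)]) hcard heW hok (by omega) (by omega) (by omega)
          have hr₂ : M₂ (pos y) = r := (h₃.eq_of_lt (by omega)).trans hM₁p
          exact ⟨W₁, τ₁, M₂, _, _, _, _, _, _, (Finset.subset_insert _ _).trans h₁, h₂, h₃,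
            by omega, hhead (.lt rfl (show n + 1 < M₁ (name e) by omega) <|
              .copy rfl (show name y ≤ E.N by omega) <| .copy rfl (show pos y ≤ E.N by omega) <|
              .copy rfl (show name e ≤ E.N by omega) <| .jump rfl <| h₅.trans <|
              .ne rfl (show pos y ≠ n + 1 by omega) <|
              .load rfl (show pos y < E.N by omega) hr₂ hr' <| .lt rfl hr <|
              .copy rfl (show name e ≤ E.N by omega) <| .jump rfl <| .refl _) (by omega)⟩
      have hu₂ : M₂ (name y) = u := (hP₁.eq_of_mem (Finset.mem_insert_self _ _)).trans hM₁y
      have hr₂ : M₂ (pos y) = r := (hP₁.eq_of_lt (by omega)).trans hM₁p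
      -- finishing `y` repairs the memory
      have hP {W₂ : Finset (Fin n)} {M₃ : ℕ → ℕ} {c : ℕ} (hW₂ : insert y W ⊆ W₂)
          (h : Painted out M₁ (insert y W) W₂ M₃) (hc : c = mark out y) : Painted out M W W₂
            (Function.update (Function.update M₃ (pos y) (name (out y)[0])) (name y) c) := by
        refine ⟨fun z hz hz' => ?_, fun z hz => ?_⟩
        · by_cases hzy : z = y
          · rw [hzy, Function.update_self, hc]
          · rw [Function.update_of_ne (fun e => hzy (name_inj.1 e)),
              Function.update_of_ne (by have := name_le z; omega),
              h.1 z hz (by simp [hzy, hz'])]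
        · rw [Function.update_of_ne (Ne.symm (hz y (hW₂ (Finset.mem_insert_self _ _)) hy))]
          by_cases hzp : z = pos y
          · rw [hzp, Function.update_self, hf]
          · rw [Function.update_of_ne hzp, h.2 z fun v hv hv' => hz v hv fun e => hv' <|
              Finset.mem_insert_of_mem e, ← hM₁, Function.update_of_ne hzp,
              Function.update_of_ne (Ne.symm (hz y (hW₂ (Finset.mem_insert_self _ _)) hy))]
      have hE {τ' : List Call} {W₂ : Finset (Fin n)}
          (h : Explores G (out y) (insert y W) τ' W₂) :
          Explores G [y] W (.pre (name y) :: τ' ++ .post (name y) :: []) W₂ :=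
        .visit hy (hG y).1 (hG y).2 h (.nil _)
      rcases Nat.lt_or_ge 1 (out y).length with h1 | h1
      · -- at least two out-neighbours
        obtain ⟨W₂, τ₂, M₃, K', a', b', f', t', x', g₁, g₂, g₃, g₄, g₅⟩ :=
          steps_list hL ih hu hr hr' (i := i) ((out y).length - 2) 0 (by omega) W₁ M₂ a b v' t' x'
            (τ ++ [.pre (name y)] ++ τ₁) (card_compl_le hW₁ hcard)
            (hW₁ (Finset.mem_insert_self _ _)) (hP₁.ok hL hok hW₁) hu₂ hr₂
            fun k h h' => (hP₁.eq_of_lt (by omega)).trans (hM₁l k h h')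
        have hτ : τ ++ (.pre (name y) :: (τ₁ ++ τ₂) ++ .post (name y) :: []) =
          τ ++ [.pre (name y)] ++ τ₁ ++ τ₂ ++ [.post (name y)] := by simp
        have hout : out y = [(out y)[0]] ++ (out y).drop (0 + 1) := by
          rw [List.singleton_append, ← List.drop_eq_getElem_cons h0, List.drop_zero]
        refine ⟨W₂, _, _, _, a', b', f', t', x', hW₁.trans g₁,
          hE (by rw [hout]; exact hE₁.append g₂),
          hP (hW₁.trans g₁) (hP₁.trans g₃ hW₁ g₁) (c := 2) (by simp only [mark]; omega), ?_,
          by rw [hτ]; exact hs₁.trans (.not_lt rfl (hL.bnd_le_pos y h1) <|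
            .add rfl rfl (show pos y + 1 ≤ E.N by omega) g₅)⟩
        omega
      · -- a single out-neighbour
        have hτ : τ ++ (.pre (name y) :: τ₁ ++ .post (name y) :: []) =
          τ ++ [.pre (name y)] ++ τ₁ ++ [.post (name y)] := by simp
        have hout : out y = [(out y)[0]] := by
          obtain ⟨e, he⟩ := List.length_eq_one_iff.1 (by omega : (out y).length = 1)
          simp [he]
        refine ⟨W₁, _, _, _, _, _, _, _, _, hW₁, hE (by rw [hout]; exact hE₁),
          hP hW₁ hP₁ (c := 1) (by simp only [mark]; omega), ?_,
          by rw [hτ]; exact hs₁.trans (.lt rfl (hL.pos_lt_bnd y (by omega)) <|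
            .copy rfl (show pos y ≤ E.N by omega) <|
            .load rfl (show pos y < E.N by omega) hr₂ hr' <| .const rfl (by omega) <|
            steps_finish (p := pos y) hu₂ hu (by omega) (by omega) hr')⟩
        omega

end Visit

/-! ### Searches from several start vertices -/

section FullSearch

variable {n : ℕ} {E : Env} {B : ℕ} {pos : Fin n → ℕ} {out : Fin n → List (Fin n)}
  {G : Digraph (Fin n)}

/-- A search that starts at the white vertex `y`. -/
theorem steps_root (hL : Layout E.N B pos out)
    (hG : ∀ v, (out v).Nodup ∧ ∀ x, x ∈ out v ↔ G.Adj v x) {y : Fin n} {W : Finset (Fin n)}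
    {M : ℕ → ℕ} {a b d f v t x i : ℕ} {τ : List Call} (hy : y ∉ W) (hM : Ok pos out W M) :
    ∃ W' τ' M' K c' a' b' d' f' v' t' x', W ⊆ W' ∧ Explores G [y] W τ' W' ∧ Painted out M W W' M' ∧
      K + 60 * weight out W ≤ 60 * weight out W' + 3 ∧
      Steps E K ⟨47, ⟨name y, n, E.N, B, n + 1, 1, a, b, d, f, v, t, x, i⟩, M, τ⟩
        ⟨111, ⟨c', n, E.N, B, n + 1, 1, a', b', d', f', v', t', x', i⟩, M', τ ++ τ'⟩ := by
  have hB := hL.bnd_le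
  have hB' := hL.le_bnd
  obtain ⟨W', τ', M', K, a', b', f', t', x', h₁, h₂, h₃, h₄, h₅⟩ :=
    visitsUpTo (E := E) hL hG _ W M y (n + 1) (n + 1) d f v t x i τ le_rfl hy hM le_rfl (by omega)
      (by omega)
  refine ⟨W', τ', M', _, _, _, _, _, _, _, _, _, (Finset.subset_insert _ _).trans h₁, h₂, h₃, ?_,
    .copy rfl (show n + 1 ≤ E.N by omega) <| .copy rfl (show n + 1 ≤ E.N by omega) <|
    h₅.trans <| .eq rfl rfl <| .refl _⟩
  omega

/-- The searches that start at the vertices that are still white, in ascending order. -/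
theorem steps_restart (hL : Layout E.N B pos out) (hfull : E.full = true)
    (hG : ∀ v, (out v).Nodup ∧ ∀ x, x ∈ out v ↔ G.Adj v x) (m : ℕ) :
    ∀ (i : ℕ) (_ : i + m = n) (W : Finset (Fin n)) (M : ℕ → ℕ) (c a b d f v t x : ℕ)
      (τ : List Call), Ok pos out W M →
    ∃ W' τ' M' K c' a' b' d' f' v' t' x' i', W ⊆ W' ∧
      Explores G ((List.finRange n).drop i) W τ' W' ∧ Painted out M W W' M' ∧
      K + 60 * weight out W ≤ 60 * weight out W' + 10 * m + 3 ∧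
      Steps E K ⟨111, ⟨c, n, E.N, B, n + 1, 1, a, b, d, f, v, t, x, i⟩, M, τ⟩
        ⟨119, ⟨c', n, E.N, B, n + 1, 1, a', b', d', f', v', t', x', i'⟩, M', τ ++ τ'⟩ := by
  have hB := hL.bnd_le
  have hB' := hL.le_bnd
  have hjump : (code E.full)[111]? = some (.jump 112) := by rw [hfull]; rfl
  induction m with
  | zero =>
    intro i hi W M c a b d f v t x τ hM
    refine ⟨W, [], M, 3, c, a, b, d, f, v, t, x, i + 1, subset_rfl, ?_, .refl _ _, by omega,
      .jump hjump <| .add rfl rfl (show i + 1 ≤ E.N by omega) <|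
      .lt rfl (show n < i + 1 by omega) <| by rw [List.append_nil]; exact .refl _⟩
    rw [List.drop_eq_nil_of_le (by simp; omega)]
    exact .nil _
  | succ m ih =>
    intro i hi W M c a b d f v t x τ hM
    obtain ⟨y, rfl⟩ : ∃ y : Fin n, i = y := ⟨⟨i, by omega⟩, rfl⟩
    have hdrop : (List.finRange n).drop y = [y] ++ (List.finRange n).drop (y + 1) := by
      rw [List.drop_eq_getElem_cons (by simp)]; simp
    have hx : M (name y) ≤ E.N := by
      by_cases hy : y ∈ W
      · have := hM.2 y hy; omega
      · rw [(hM.1 y hy).1]; exact (Nat.le_add_right _ _).trans (hL.pos_add_le y)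
    have hyn := name_le y
    have hname : (y : ℕ) + 1 = name y := rfl
    have hs (l : ℕ) (c' : St) (h : Steps E l ⟨115, ⟨c, n, E.N, B, n + 1, 1, a, b, d, f, v,
        M (name y), x, name y⟩, M, τ⟩ c') : Steps E (l + 4)
        ⟨111, ⟨c, n, E.N, B, n + 1, 1, a, b, d, f, v, t, x, y⟩, M, τ⟩ c' :=
      .jump hjump <| .add rfl rfl (show (y : ℕ) + 1 ≤ E.N by omega) <| .not_lt rfl hyn <|
        .load rfl (show name y < E.N by omega) rfl hx h
    by_cases hy : y ∈ W
    · obtain ⟨W', τ', M', K, c', a', b', d', f', v', t', x', i', h₁, h₂, h₃, h₄, h₅⟩ :=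
        ih (y + 1) (by omega) W M c a b d f v (M (name y)) x τ hM
      refine ⟨W', τ', M', _, _, _, _, _, _, _, _, _, _, h₁, hdrop ▸ .skip hy h₂, h₃, ?_,
        hs _ _ <| .not_lt rfl (hM.2 y hy) <| .jump rfl h₅⟩
      omega
    · obtain ⟨W₁, τ₁, M₁, K₁, c, a, b, d, f, v, t, x, g₁, g₂, g₃, g₄, g₅⟩ :=
        steps_root (E := E) (a := a) (b := b) (d := d) (f := f) (v := v) (t := M (name y)) (x := x)
          (i := name y) (τ := τ) hL hG hy hM
      obtain ⟨W', τ', M', K, c', a', b', d', f', v', t', x', i', h₁, h₂, h₃, h₄, h₅⟩ :=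
        ih (y + 1) (by omega) W₁ M₁ c a b d f v t x (τ ++ τ₁) (g₃.ok hL hM g₁)
      have hpos := hL.le_pos y
      rw [List.append_assoc] at h₅
      refine ⟨W', τ₁ ++ τ', M', _, _, _, _, _, _, _, _, _, _, g₁.trans h₁, hdrop ▸ g₂.append h₂,
        g₃.trans h₃ g₁ h₁, ?_, hs _ _ <| .lt rfl (show n + 1 < M (name y) by
          rw [(hM.1 y hy).1]; omega) <| .copy rfl (show name y ≤ E.N by omega) <| .jump rfl <|
          g₅.trans h₅⟩
      omega

/-- The search as a whole. -/
theorem steps_search (hL : Layout E.N B pos out)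
    (hG : ∀ v, (out v).Nodup ∧ ∀ x, x ∈ out v ↔ G.Adj v x) {y : Fin n} {M : ℕ → ℕ}
    {a b d f v t x i : ℕ} (hM : ∀ v, Intact pos out M v) :
    ∃ W' τ' M' K c' a' b' d' f' v' t' x' i',
      (if E.full then IsDFSForest G y τ' else IsDFSFrom G y τ') ∧
      Painted out M ∅ W' M' ∧ K ≤ 60 * weight out Finset.univ + 10 * n + 7 ∧
      Steps E K ⟨46, ⟨name y, n, E.N, B, n + 1, 1, a, b, d, f, v, t, x, i⟩, M, []⟩
        ⟨119, ⟨c', n, E.N, B, n + 1, 1, a', b', d', f', v', t', x', i'⟩, M', τ'⟩ := by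
  have hok : Ok pos out ∅ M := ⟨fun v _ => hM v, by simp⟩
  obtain ⟨W₁, τ₁, M₁, K₁, c', a', b', d', f', v', t', x', g₁, g₂, g₃, g₄, g₅⟩ :=
    steps_root (E := E) (a := a) (b := b) (d := d) (f := f) (v := v) (t := t) (x := x) (i := 0)
      (τ := []) hL hG (Finset.notMem_empty y) hok
  have hmono (W : Finset (Fin n)) : weight out W ≤ weight out Finset.univ :=
    Finset.sum_le_sum_of_subset (Finset.subset_univ W)
  have h0 : weight out (∅ : Finset (Fin n)) = 0 := rfl
  cases hfull : E.full with
  | false =>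
    have hjump : (code E.full)[111]? = some (.jump 119) := by rw [hfull]; rfl
    have := hmono W₁
    refine ⟨W₁, τ₁, M₁, _, _, _, _, _, _, _, _, _, _, ⟨W₁, g₂⟩, g₃, ?_,
      .const rfl (Nat.zero_le _) <| g₅.trans <| .jump hjump <| .refl _⟩
    omega
  | true =>
    obtain ⟨W₂, τ₂, M₂, K₂, c', a', b', d', f', v', t', x', i', h₁, h₂, h₃, h₄, h₅⟩ :=
      steps_restart hL hfull hG n 0 (Nat.zero_add n) W₁ M₁ c' a' b' d' f' v' t' x' _
        (g₃.ok hL hok g₁)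
    have := hmono W₂
    have hy : y ∈ W₁ := by
      cases g₂ with
      | skip h _ => exact absurd h (Finset.notMem_empty y)
      | visit _ _ _ h h' => exact h'.subset (h.subset (Finset.mem_insert_self _ _))
    refine ⟨W₂, τ₁ ++ τ₂, M₂, _, _, _, _, _, _, _, _, _, _,
      ⟨(List.finRange n).filter (· ≠ y), W₂, ?_, fun v => ?_, ?_⟩, g₃.trans h₃ g₁ h₁, ?_,
      .const rfl (Nat.zero_le _) <| g₅.trans h₅⟩
    · exact List.nodup_cons.2 ⟨by simp, (List.nodup_finRange n).filter _⟩
    · by_cases h : v = y <;> simp [h]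
    · exact g₂.append (h₂.filter_ne hy)
    · omega

end FullSearch

/-! ### Rearranging the lists -/

/-- Exchange the last two entries of a list. -/
def swapLast {α : Type*} (l : List α) : List α :=
  l.take (l.length - 2) ++ (l.drop (l.length - 2)).reverse

theorem swapLast_perm {α : Type*} (l : List α) : (swapLast l).Perm l := by
  have := (List.reverse_perm (l.drop (l.length - 2))).append_left (l.take (l.length - 2))
  rwa [List.take_append_drop] at this

@[simp]
theorem length_swapLast {α : Type*} (l : List α) : (swapLast l).length = l.length :=
  (swapLast_perm l).length_eq

theorem map_swapLast {α β : Type*} (f : α → β) (l : List α) :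
    (swapLast l).map f = swapLast (l.map f) := by
  simp [swapLast, List.map_take, List.map_drop]

theorem swapLast_getElem {α : Type*} (l : List α) {j : ℕ} (h : j + 2 < l.length) :
    (swapLast l)[j]'(by simp; omega) = l[j] := by
  simp only [swapLast]
  rw [List.getElem_append_left (by simp; omega), List.getElem_take]

theorem swapLast_getElem_fst {α : Type*} (l : List α) {j : ℕ} (h : j + 2 = l.length) :
    (swapLast l)[j]'(by simp; omega) = l[j + 1] := by
  simp only [swapLast]
  rw [List.getElem_append_right (by simp; omega), List.getElem_reverse, List.getElem_drop]
  congr 1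
  simp only [List.length_take, List.length_drop]
  omega

theorem swapLast_getElem_snd {α : Type*} (l : List α) {j : ℕ} (h : j + 2 = l.length) :
    (swapLast l)[j + 1]'(by simp; omega) = l[j] := by
  simp only [swapLast]
  rw [List.getElem_append_right (by simp; omega), List.getElem_reverse, List.getElem_drop]
  congr 1
  simp only [List.length_take, List.length_drop]
  omega

/-- In a sorted list with the last two entries exchanged, the only descent is at the end. -/
theorem swapLast_descent {α : Type*} [LinearOrder α] {l : List α} (hl : l.Pairwise (· < ·)) {j : ℕ}
    (h : j + 1 < (swapLast l).length) :
    (swapLast l)[j + 1] < (swapLast l)[j] ↔ j + 2 = l.length := by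
  have hlt {a b : ℕ} (hab : a < b) (hb : b < l.length) : l[a] < l[b] :=
    List.pairwise_iff_getElem.1 hl a b (by omega) hb hab
  simp only [length_swapLast] at h
  rcases Nat.lt_or_ge (j + 2) l.length with h2 | h2
  · refine ⟨fun h' => absurd h' (not_lt.2 (le_of_lt ?_)), fun h' => by omega⟩
    rw [swapLast_getElem l h2]
    rcases Nat.lt_or_ge (j + 3) l.length with h3 | h3
    · rw [swapLast_getElem l h3]
      exact hlt (by omega) _
    · rw [swapLast_getElem_fst l (by omega)]
      exact hlt (by omega) _
  · have h2 : j + 2 = l.length := by omega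
    refine ⟨fun _ => h2, fun _ => ?_⟩
    rw [swapLast_getElem_fst l h2, swapLast_getElem_snd l h2]
    exact hlt (by omega) _

/-- The memory holds the list `l` from the position `p` on. -/
def Holds (M : ℕ → ℕ) (p : ℕ) (l : List ℕ) : Prop :=
  ∀ j (h : j < l.length), M (p + j) = l[j]

/-- Adjacency lists of the vertices `1, …, n`, in ascending order. -/
structure SortedLists (n : ℕ) (L : ℕ → List ℕ) : Prop where
  zero : L 0 = []
  sorted : ∀ u, (L u).Pairwise (· < ·)
  le : ∀ u, ∀ x ∈ L u, x ≤ n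

section Positions

variable (n : ℕ) (L : ℕ → List ℕ)

/-- The position of the list of `v` in the input. -/
def start (v : ℕ) : ℕ := n + 2 + ∑ u ∈ Finset.range v, (L u).length

/-- The number of lists of length 1 that precede the list of `v`. -/
def ones (v : ℕ) : ℕ := ∑ u ∈ Finset.range v, if (L u).length = 1 then 1 else 0

/-- The total length of the lists of length at least 2 that precede the list of `v`. -/
def longs (v : ℕ) : ℕ := ∑ u ∈ Finset.range v, if 2 ≤ (L u).length then (L u).length else 0

/-- Where the lists of length at least 2 begin after the rearrangement: behind the `n + 2` words
that precede all lists, and the lists of length 1. -/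
def bound : ℕ := n + 2 + ones L (n + 1)

/-- The table entry of `v` after the rearrangement. The length of the input stands for an empty
list. -/
def target (v : ℕ) : ℕ :=
  if (L v).length = 0 then start n L (n + 1)
  else if (L v).length = 1 then n + 2 + ones L v else bound n L + longs L v

variable {n L}

theorem start_succ (v : ℕ) : start n L (v + 1) = start n L v + (L v).length := by
  simp [start, Finset.sum_range_succ, add_assoc]

theorem ones_succ (v : ℕ) : ones L (v + 1) = ones L v + if (L v).length = 1 then 1 else 0 :=
  Finset.sum_range_succ _ _

theorem longs_succ (v : ℕ) :
    longs L (v + 1) = longs L v + if 2 ≤ (L v).length then (L v).length else 0 :=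
  Finset.sum_range_succ _ _

/-- Every list is empty, or of length 1, or longer. -/
theorem start_eq (v : ℕ) : start n L v = n + 2 + ones L v + longs L v := by
  induction v with
  | zero => simp [start, ones, longs]
  | succ v ih =>
    rw [start_succ, ones_succ, longs_succ, ih]
    split_ifs <;> omega

theorem start_mono {u v : ℕ} (h : u ≤ v) : start n L u ≤ start n L v :=
  Nat.add_le_add_left (Finset.sum_le_sum_of_subset (Finset.range_mono h)) _

theorem ones_mono {u v : ℕ} (h : u ≤ v) : ones L u ≤ ones L v :=
  Finset.sum_le_sum_of_subset (Finset.range_mono h)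

theorem longs_mono {u v : ℕ} (h : u ≤ v) : longs L u ≤ longs L v :=
  Finset.sum_le_sum_of_subset (Finset.range_mono h)

theorem start_one (hL : SortedLists n L) : start n L 1 = n + 2 := by
  simp [start, hL.zero]

theorem ones_one (hL : SortedLists n L) : ones L 1 = 0 := by simp [ones, hL.zero]

theorem longs_one (hL : SortedLists n L) : longs L 1 = 0 := by simp [longs, hL.zero]

theorem bound_add (n : ℕ) (L : ℕ → List ℕ) :
    bound n L + longs L (n + 1) = start n L (n + 1) := by
  rw [bound, start_eq]

/-- The rearrangement moves lists of length at least 2 to the right. -/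
theorem start_le {v : ℕ} (hv : v ≤ n + 1) : start n L v ≤ bound n L + longs L v := by
  have := ones_mono (L := L) hv
  rw [start_eq, bound]; omega

end Positions

/-! ### The passes before the search -/

section Forward

variable {E : Env} {n : ℕ} {L : ℕ → List ℕ}

/-- The memory holds the sorted standard representation. The word `n + 1` is the total length of the
lists. -/
structure IsInput (n : ℕ) (L : ℕ → List ℕ) (M : ℕ → ℕ) : Prop where
  zero : M 0 = n
  total : M (n + 1) + (n + 2) = start n L (n + 1)
  table : ∀ u, 1 ≤ u → u ≤ n → M u = start n L u
  list : ∀ u, 1 ≤ u → u ≤ n → Holds M (start n L u) (L u)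

/-- The list of `u` during the transition between the input and its rearrangement: a list of length
1 is kept in the table, and a longer one is at its place in the rearrangement. -/
def Moved (n : ℕ) (L : ℕ → List ℕ) (M : ℕ → ℕ) (u : ℕ) : Prop :=
  ((L u).length = 0 → M u = start n L (n + 1)) ∧ (∀ h : (L u).length = 1, M u = (L u)[0]) ∧
    (2 ≤ (L u).length → Holds M (bound n L + longs L u) (swapLast (L u)))

/-- The state of the first pass when the vertices greater than `v` have been treated. -/
structure Pass1 (n : ℕ) (L : ℕ → List ℕ) (v : ℕ) (M : ℕ → ℕ) : Prop where
  zero : M 0 = n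
  total : M (n + 1) + (n + 2) = start n L (n + 1)
  table : ∀ u, 1 ≤ u → u ≤ v → M u = start n L u
  list : ∀ u, 1 ≤ u → u ≤ v → Holds M (start n L u) (L u)
  moved : ∀ u, v < u → u ≤ n → Moved n L M u
  table' : ∀ u, v < u → u ≤ n → 2 ≤ (L u).length → M u = bound n L + longs L u

/-- Copy a block of `m` words to the right, from right to left, so that an overlap does no harm. -/
theorem steps_copyDown {p q : ℕ} (hpq : p ≤ q) {a b c d e f g x i : ℕ} (m : ℕ) :
    ∀ (M : ℕ → ℕ) (t : ℕ), q + m ≤ E.N → (∀ j < m, M (p + j) ≤ E.N) →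
    ∃ M' t', (∀ j < m, M' (q + j) = M (p + j)) ∧ (∀ z, z < q ∨ q + m ≤ z → M' z = M z) ∧
      Steps E (6 * m + 1) ⟨22, ⟨a, b, c, q + m, d, 1, p, e, p + m, f, g, t, x, i⟩, M, []⟩
        ⟨28, ⟨a, b, c, q, d, 1, p, e, p, f, g, t', x, i⟩, M', []⟩ := by
  induction m with
  | zero => exact fun M t _ _ => ⟨M, t, by simp, by simp, .eq rfl rfl <| .refl _⟩
  | succ m ih =>
    intro M t hq hM
    have hv := hM m (by omega)
    obtain ⟨M', t', h₁, h₂, h₃⟩ := ih (Function.update M (q + m) (M (p + m))) (M (p + m)) (by omega)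
      fun j hj => by rw [Function.update_of_ne (by omega)]; exact hM j (by omega)
    refine ⟨M', t', fun j hj => ?_, fun z hz => ?_, .ne rfl (show p ≠ p + (m + 1) by omega) <|
      .sub rfl (show p + m + 1 = p + (m + 1) from rfl) (by omega) <|
      .load rfl (show p + m < E.N by omega) rfl hv <|
      .sub rfl (show q + m + 1 = q + (m + 1) from rfl) (by omega) <|
      .store rfl (show q + m < E.N by omega) <| .jump rfl h₃⟩
    · rcases Nat.lt_or_ge j m with hj' | hj'
      · rw [h₁ j hj', Function.update_of_ne (by omega)]
      · obtain rfl : j = m := by omega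
        rw [h₂ _ (by omega), Function.update_self]
    · rw [h₂ z (by omega), Function.update_of_ne (by omega)]

/-- Move a list of length at least 2 to the right, exchange its last two entries, and put its new
position into the table. -/
theorem steps_moveRight {p q : ℕ} (hpq : p ≤ q) {l : List ℕ} (hl : 2 ≤ l.length)
    {a b c d e f g t x i : ℕ} {M : ℕ → ℕ} (hq : q + l.length ≤ E.N) (hlN : ∀ y ∈ l, y ≤ E.N)
    (hM : Holds M p l) (hi : i < q) :
    ∃ M' t' x', Holds M' q (swapLast l) ∧ M' i = q ∧
      (∀ z, z < q ∨ q + l.length ≤ z → z ≠ i → M' z = M z) ∧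
      Steps E (6 * l.length) ⟨14, ⟨a, b, c, q + l.length, d, 1, p, e, p + l.length, f, g, t, x, i⟩,
        M, []⟩ ⟨35, ⟨a, b, c, q, d, 1, p, e, p, f, g, t', x', i⟩, M', []⟩ := by
  obtain ⟨m, hm⟩ : ∃ m, l.length = m + 2 := ⟨_, (Nat.sub_add_cancel hl).symm⟩
  have h₁ : M (p + (m + 1)) = l[m + 1] := hM (m + 1) (by omega)
  have h₂ : M (p + m) = l[m] := hM m (by omega)
  have hN (j : ℕ) (h : j < l.length) : l[j] ≤ E.N := hlN _ (List.getElem_mem h)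
  set M₁ := Function.update (Function.update M (q + (m + 1)) l[m]) (q + m) l[m + 1] with hM₁
  have hk (z : ℕ) (hz : z < q + m ∨ q + (m + 2) ≤ z) : M₁ z = M z := by
    rw [hM₁, Function.update_of_ne (by omega), Function.update_of_ne (by omega)]
  have hcopy (j : ℕ) (hj : j < m) : M₁ (p + j) = l[j] := by
    rw [hk _ (by omega), hM j (by omega)]
  obtain ⟨M', t', g₁, g₂, g₃⟩ := steps_copyDown (E := E) hpq (a := a) (b := b) (c := c) (d := d)
    (e := e) (f := f) (g := g) (x := l[m]) (i := i) m M₁ l[m + 1] (by omega)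
    fun j hj => by rw [hcopy j hj]; exact hN j _
  refine ⟨Function.update M' i q, t', l[m], fun j hj => ?_, by simp, fun z hz hzi => ?_, ?_⟩
  · rw [length_swapLast] at hj
    rw [Function.update_of_ne (by omega)]
    rcases lt_trichotomy j m with h | rfl | h
    · rw [g₁ j h, hcopy j h, swapLast_getElem l (by omega)]
    · rw [g₂ _ (by omega), swapLast_getElem_fst l (by omega), hM₁, Function.update_self]
    · obtain rfl : j = m + 1 := by omega
      rw [g₂ _ (by omega), swapLast_getElem_snd l (by omega), hM₁,
        Function.update_of_ne (by omega), Function.update_self]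
  · rw [Function.update_of_ne hzi, g₂ z (by omega), hk z (by omega)]
  · simp only [hm]
    refine .mono (.sub rfl (show p + (m + 1) + 1 = p + (m + 2) from rfl) (by omega) <|
      .load rfl (show p + (m + 1) < E.N by omega) h₁ (hN _ _) <|
      .sub rfl (show p + m + 1 = p + (m + 1) from rfl) (by omega) <|
      .load rfl (show p + m < E.N by omega) h₂ (hN _ _) <|
      .sub rfl (show q + (m + 1) + 1 = q + (m + 2) from rfl) (by omega) <|
      .store rfl (show q + (m + 1) < E.N by omega) <|
      .sub rfl (show q + m + 1 = q + (m + 1) from rfl) (by omega) <|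
      .store rfl (show q + m < E.N by omega) <| g₃.trans <|
      .store rfl (show i < E.N by omega) <| .jump rfl <| .refl _) (by omega)

/-- One iteration of the first pass. -/
theorem steps_pass1 (hL : SortedLists n L) (hN : E.N = start n L (n + 1)) {v : ℕ} (hv : v < n)
    {s t x p : ℕ} {M : ℕ → ℕ} (hM : Pass1 n L (v + 1) M) :
    ∃ M' t' x' p', Pass1 n L v M' ∧ Steps E (6 * (L (v + 1)).length + 11)
      ⟨9, ⟨s, n, E.N, bound n L + longs L (v + 2), n + 1, 1, p, 0, start n L (v + 2), 0, 0, t, x,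
        v + 1⟩, M, []⟩
      ⟨9, ⟨s, n, E.N, bound n L + longs L (v + 1), n + 1, 1, p', 0, start n L (v + 1), 0, 0, t', x',
        v⟩, M', []⟩ := by
  have h₁ := start_mono (n := n) (L := L) (u := v + 1 + 1) (v := n + 1) (by omega)
  have h₂ := longs_mono (L := L) (u := v + 1 + 1) (v := n + 1) (by omega)
  have h₃ := bound_add n L
  have h₄ := start_le (n := n) (L := L) (v := v + 1) (by omega)
  have h₅ : n + 2 ≤ bound n L := by rw [bound]; omega
  have hs := start_succ (n := n) (L := L) (v + 1)
  have hl := longs_succ (L := L) (v + 1)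
  have h0 : n + 2 ≤ start n L (v + 1) := Nat.le_add_right _ _
  have hT := hM.table (v + 1) (by omega) le_rfl
  have hH := hM.list (v + 1) (by omega) le_rfl
  -- a common form of the new state
  have key (M' : ℕ → ℕ) (hmv : Moved n L M' (v + 1))
      (ht' : 2 ≤ (L (v + 1)).length → M' (v + 1) = bound n L + longs L (v + 1))
      (hk : ∀ z, z < bound n L + longs L (v + 1) ∨ bound n L + longs L (v + 2) ≤ z → z ≠ v + 1 →
        M' z = M z) : Pass1 n L v M' := by
    have hMz (z : ℕ) (hz : z ≤ n + 1) (hz' : z ≠ v + 1) : M' z = M z := hk z (by omega) hz'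
    refine ⟨by rw [hMz 0 (by omega) (by omega), hM.zero],
      by rw [hMz (n + 1) (by omega) (by omega), hM.total],
      fun u hu hu' => by rw [hMz u (by omega) (by omega), hM.table u hu (by omega)],
      fun u hu hu' j hj => ?_, fun u hu hu' => ?_, fun u hu hu' hd => ?_⟩
    · have := start_mono (n := n) (L := L) (u := u + 1) (v := v + 1) (by omega)
      have := start_succ (n := n) (L := L) u
      have : n + 2 ≤ start n L u := Nat.le_add_right _ _
      rw [hk _ (by omega) (by omega), hM.list u hu (by omega) j hj]
    · rcases eq_or_ne u (v + 1) with rfl | hne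
      · exact hmv
      · obtain ⟨m₀, m₁, m₂⟩ := hM.moved u (by omega) hu'
        have := hMz u (by omega) hne
        refine ⟨fun h => this ▸ m₀ h, fun h => this ▸ m₁ h, fun h j hj => ?_⟩
        have := longs_mono (L := L) (u := v + 2) (v := u) (by omega)
        rw [hk _ (by omega) (by omega), m₂ h j hj]
    · rcases eq_or_ne u (v + 1) with rfl | hne
      · exact ht' hd
      · rw [hMz u (by omega) hne, hM.table' u (by omega) hu' hd]
  have e : v + 1 + 1 = v + 2 := rfl
  rw [e] at hs hl h₁ h₂
  rw [hs, hl]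
  rcases Nat.lt_trichotomy (L (v + 1)).length 1 with hd | hd | hd
  · rw [if_neg (by omega), show (L (v + 1)).length = 0 by omega]
    refine ⟨Function.update M (v + 1) E.N, t, x, start n L (v + 1),
      key _ ⟨fun _ => by simp [hN], fun h => by omega, fun h => by omega⟩ (fun h => by omega)
        fun z _ hz => Function.update_of_ne hz _ _,
      .mono (.ne rfl (show v + 1 ≠ 0 by omega) <|
        .load rfl (show v + 1 < E.N by omega) hT (by omega) <|
        .eq rfl rfl <| .store rfl (show v + 1 < E.N by omega) <|
        .sub rfl (show v + 1 = v + 1 from rfl) (by omega) <| .jump rfl <| .refl _) (by omega)⟩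
  · rw [if_neg (by omega), hd]
    have hx : M (start n L (v + 1)) = (L (v + 1))[0] := hH 0 (by omega)
    have hx' := hL.le (v + 1) _ (List.getElem_mem (l := L (v + 1)) (n := 0) (by omega))
    refine ⟨Function.update M (v + 1) (L (v + 1))[0], start n L (v + 1) + 1, (L (v + 1))[0],
      start n L (v + 1),
      key _ ⟨fun h => by omega, fun _ => Function.update_self _ _ _, fun h => by omega⟩
        (fun h => by omega) fun z _ hz => Function.update_of_ne hz _ _,
      .mono (.ne rfl (show v + 1 ≠ 0 by omega) <|
        .load rfl (show v + 1 < E.N by omega) hT (by omega) <|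
        .ne rfl (show start n L (v + 1) ≠ start n L (v + 1) + 1 by omega) <|
        .add rfl rfl (show start n L (v + 1) + 1 ≤ E.N by omega) <| .eq rfl rfl <|
        .load rfl (show start n L (v + 1) < E.N by omega) hx (by omega) <|
        .store rfl (show v + 1 < E.N by omega) <|
        .copy rfl (show start n L (v + 1) ≤ E.N by omega) <| .jump rfl <|
        .sub rfl (show v + 1 = v + 1 from rfl) (by omega) <| .jump rfl <| .refl _) (by omega)⟩
  · rw [if_pos (by omega)] at hl ⊢
    rw [← Nat.add_assoc]
    obtain ⟨M', t', x', g₁, g₂, g₃, g₄⟩ := steps_moveRight (E := E) h₄ (l := L (v + 1)) hd (a := s)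
      (b := n) (c := E.N) (d := n + 1) (e := 0) (f := 0) (g := 0) (t := start n L (v + 1) + 1)
      (x := x) (i := v + 1) (by omega) (fun y hy => by have := hL.le _ y hy; omega) hH (by omega)
    exact ⟨M', t', x', start n L (v + 1), key _ ⟨fun h => by omega, fun h => by omega, fun _ => g₁⟩
        (fun _ => g₂) fun z hz hz' => g₃ z (by omega) hz',
      .mono (.ne rfl (show v + 1 ≠ 0 by omega) <|
        .load rfl (show v + 1 < E.N by omega) hT (by omega) <|
        .ne rfl (show start n L (v + 1) ≠ start n L (v + 1) + (L (v + 1)).length by omega) <|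
        .add rfl rfl (show start n L (v + 1) + 1 ≤ E.N by omega) <|
        .ne rfl (show start n L (v + 1) + 1 ≠ start n L (v + 1) + (L (v + 1)).length by omega) <|
        g₄.trans <| .sub rfl (show v + 1 = v + 1 from rfl) (by omega) <| .jump rfl <| .refl _)
        (by omega)⟩

/-- The state of the second pass when the vertices up to `v` have been treated. -/
structure Pass2 (n : ℕ) (L : ℕ → List ℕ) (v : ℕ) (M : ℕ → ℕ) : Prop where
  zero : M 0 = n
  total : M (n + 1) + (n + 2) = start n L (n + 1)
  table : ∀ u, 1 ≤ u → u ≤ v → M u = target n L u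
  list : ∀ u, 1 ≤ u → u ≤ v → Holds M (target n L u) (swapLast (L u))
  moved : ∀ u, v < u → u ≤ n → Moved n L M u
  table' : ∀ u, v < u → u ≤ n → 2 ≤ (L u).length → M u = bound n L + longs L u

/-- One iteration of the second pass. -/
theorem steps_pass2 (hL : SortedLists n L) (hN : E.N = start n L (n + 1)) {v : ℕ} (hv : v < n)
    {s b p t x : ℕ} {M : ℕ → ℕ} (hM : Pass2 n L v M) :
    ∃ M' t', Pass2 n L (v + 1) M' ∧ Steps E 8
      ⟨38, ⟨s, n, E.N, b, n + 1, 1, p, 0, n + 2 + ones L (v + 1), 0, 0, t, x, v⟩, M, []⟩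
      ⟨38, ⟨s, n, E.N, b, n + 1, 1, p, 0, n + 2 + ones L (v + 2), 0, 0, t', x, v + 1⟩, M', []⟩ := by
  have h₁ := ones_mono (L := L) (u := v + 1 + 1) (v := n + 1) (by omega)
  have h₃ := bound_add n L
  have ho := ones_succ (L := L) (v + 1)
  have hl := longs_succ (L := L) (v + 1)
  have h₂ := longs_mono (L := L) (u := v + 1 + 1) (v := n + 1) (by omega)
  have hb : bound n L = n + 2 + ones L (n + 1) := rfl
  obtain ⟨m₀, m₁, m₂⟩ := hM.moved (v + 1) (by omega) hv
  have e : v + 1 + 1 = v + 2 := rfl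
  rw [e] at h₁ ho hl h₂
  -- a common form of the new state
  have key (M' : ℕ → ℕ) (ht : M' (v + 1) = target n L (v + 1))
      (hH : Holds M' (target n L (v + 1)) (swapLast (L (v + 1))))
      (hk : ∀ z, z < n + 2 + ones L (v + 1) ∨ n + 2 + ones L (v + 2) ≤ z → z ≠ v + 1 →
        M' z = M z) : Pass2 n L (v + 1) M' := by
    have hMz (z : ℕ) (hz : z ≤ n + 1) (hz' : z ≠ v + 1) : M' z = M z := hk z (by omega) hz'
    refine ⟨by rw [hMz 0 (by omega) (by omega), hM.zero],
      by rw [hMz (n + 1) (by omega) (by omega), hM.total],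
      fun u hu hu' => ?_, fun u hu hu' => ?_, fun u hu hu' => ?_, fun u hu hu' hd => ?_⟩
    · rcases eq_or_ne u (v + 1) with rfl | hne
      · exact ht
      · rw [hMz u (by omega) hne, hM.table u hu (by omega)]
    · rcases eq_or_ne u (v + 1) with rfl | hne
      · exact hH
      · intro j hj
        have hu₁ := ones_succ (L := L) u
        have hu₂ := ones_mono (L := L) (u := u + 1) (v := v + 1) (by omega)
        have hp : target n L u + j < n + 2 + ones L (v + 1) ∨
            n + 2 + ones L (v + 2) ≤ target n L u + j := by
          rw [length_swapLast] at hj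
          rw [target, if_neg (by omega)]
          split_ifs at hu₁ ⊢ <;> omega
        have : n + 2 ≤ target n L u := by
          rw [length_swapLast] at hj
          rw [target, if_neg (by omega)]
          split_ifs <;> omega
        rw [hk _ hp (by omega), hM.list u hu (by omega) j hj]
    · obtain ⟨m₀, m₁, m₂⟩ := hM.moved u (by omega) hu'
      have := hMz u (by omega) (by omega)
      refine ⟨fun h => this ▸ m₀ h, fun h => this ▸ m₁ h, fun h j hj => ?_⟩
      rw [hk _ (by omega) (by omega), m₂ h j hj]
    · rw [hMz u (by omega) (by omega), hM.table' u (by omega) hu' hd]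
  rw [ho]
  rcases Nat.lt_trichotomy (L (v + 1)).length 1 with hd | hd | hd
  · have ht : target n L (v + 1) = E.N := by rw [target, if_pos (by omega), hN]
    have hm : M (v + 1) = E.N := by rw [m₀ (by omega), hN]
    rw [if_neg (by omega)]
    exact ⟨M, E.N, key M (by rw [hm, ht])
      (fun j hj => by rw [length_swapLast] at hj; omega) (fun _ _ _ => rfl),
      .mono (.add rfl rfl (show v + 1 ≤ E.N by omega) <| .not_lt rfl hv <|
        .load rfl (show v + 1 < E.N by omega) hm le_rfl <| .lt rfl (show n < E.N by omega) <|
        .refl _) (by omega)⟩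
  · have ht : target n L (v + 1) = n + 2 + ones L (v + 1) := by
      rw [target, if_neg (by omega), if_pos hd]
    have hx := hL.le (v + 1) _ (List.getElem_mem (l := L (v + 1)) (n := 0) (by omega))
    rw [if_pos hd] at ho ⊢
    refine ⟨Function.update (Function.update M (n + 2 + ones L (v + 1)) (L (v + 1))[0]) (v + 1)
      (n + 2 + ones L (v + 1)), (L (v + 1))[0], key _ (by simp [ht]) (fun j hj => ?_)
      (fun z hz hz' => by rw [Function.update_of_ne hz', Function.update_of_ne (by omega)]),
      .mono (.add rfl rfl (show v + 1 ≤ E.N by omega) <| .not_lt rfl hv <|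
        .load rfl (show v + 1 < E.N by omega) (m₁ hd) (by omega) <| .not_lt rfl hx <|
        .store rfl (show n + 2 + ones L (v + 1) < E.N by omega) <|
        .store rfl (show v + 1 < E.N by omega) <|
        .add rfl rfl (show n + 2 + ones L (v + 1) + 1 ≤ E.N by omega) <| .jump rfl <|
        .refl _) (by omega)⟩
    have hj' := hj
    rw [length_swapLast] at hj'
    obtain rfl : j = 0 := by omega
    have h1 : swapLast (L (v + 1)) = L (v + 1) := by
      obtain ⟨y, hy⟩ := List.length_eq_one_iff.1 hd
      rw [hy]; rfl
    rw [Function.update_of_ne (by omega), ht]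
    simp [h1]
  · have ht : target n L (v + 1) = bound n L + longs L (v + 1) := by
      rw [target, if_neg (by omega), if_neg (by omega)]
    rw [if_neg (by omega)]
    have hm := hM.table' (v + 1) (by omega) hv hd
    rw [if_pos (by omega)] at hl
    exact ⟨M, bound n L + longs L (v + 1), key M (by rw [hm, ht]) (ht ▸ m₂ hd) (fun _ _ _ => rfl),
      .mono (.add rfl rfl (show v + 1 ≤ E.N by omega) <| .not_lt rfl hv <|
        .load rfl (show v + 1 < E.N by omega) hm (by omega) <|
        .lt rfl (show n < bound n L + longs L (v + 1) by omega) <|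
        .refl _) (by omega)⟩

/-- The first pass as a whole. -/
theorem steps_pass1_loop (hL : SortedLists n L) (hN : E.N = start n L (n + 1)) {s : ℕ} (v : ℕ) :
    ∀ {t x p : ℕ} {M : ℕ → ℕ}, v ≤ n → Pass1 n L v M → ∃ M' t' x' p', Pass1 n L 0 M' ∧
      Steps E (6 * (start n L (v + 1) - (n + 2)) + 11 * v + 1)
        ⟨9, ⟨s, n, E.N, bound n L + longs L (v + 1), n + 1, 1, p, 0, start n L (v + 1), 0, 0, t, x,
          v⟩, M, []⟩
        ⟨37, ⟨s, n, E.N, bound n L, n + 1, 1, p', 0, n + 2, 0, 0, t', x', 0⟩, M', []⟩ := by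
  induction v with
  | zero =>
    intro t x p M _ hM
    rw [zero_add, longs_one hL, start_one hL, Nat.add_zero]
    exact ⟨M, t, x, p, hM, .mono (.eq rfl rfl <| .refl _) (by omega)⟩
  | succ v ih =>
    intro t x p M hv hM
    obtain ⟨M₁, t, x, p, g₁, g₂⟩ := steps_pass1 (E := E) hL hN hv (s := s) (t := t) (x := x)
      (p := p) hM
    obtain ⟨M', t', x', p', h₁, h₂⟩ := ih (t := t) (x := x) (p := p) (by omega) g₁
    refine ⟨M', t', x', p', h₁, (g₂.trans h₂).mono ?_⟩
    have := start_succ (n := n) (L := L) (v + 1)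
    have : n + 2 ≤ start n L (v + 1) := Nat.le_add_right _ _
    omega

/-- The second pass as a whole. -/
theorem steps_pass2_loop (hL : SortedLists n L) (hN : E.N = start n L (n + 1)) {s b p x : ℕ}
    (m : ℕ) : ∀ {v t : ℕ} {M : ℕ → ℕ}, v + m = n → Pass2 n L v M → ∃ M' t', Pass2 n L n M' ∧
      Steps E (8 * m + 2)
        ⟨38, ⟨s, n, E.N, b, n + 1, 1, p, 0, n + 2 + ones L (v + 1), 0, 0, t, x, v⟩, M, []⟩
        ⟨46, ⟨s, n, E.N, b, n + 1, 1, p, 0, n + 2 + ones L (n + 1), 0, 0, t', x, n + 1⟩, M',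
          []⟩ := by
  have : n + 2 ≤ start n L (n + 1) := Nat.le_add_right _ _
  induction m with
  | zero =>
    rintro v t M rfl hM
    exact ⟨M, t, hM, .add rfl rfl (show v + 1 ≤ E.N by omega) <| .lt rfl (Nat.lt_succ_self v) <|
      .refl _⟩
  | succ m ih =>
    intro v t M hv hM
    obtain ⟨M₁, t, g₁, g₂⟩ := steps_pass2 (E := E) hL hN (by omega) (s := s) (b := b) (p := p)
      (t := t) (x := x) hM
    obtain ⟨M', t', h₁, h₂⟩ := ih (t := t) (by omega) g₁
    exact ⟨M', t', h₁, (g₂.trans h₂).mono (by omega)⟩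

/-- The rearrangement as a whole. -/
theorem steps_rearrange (hL : SortedLists n L) (hN : E.N = start n L (n + 1)) (hn : 0 < n) {s : ℕ}
    {M : ℕ → ℕ} (hM : IsInput n L M) : ∃ M' t p d x i, Pass2 n L n M' ∧
      Steps E (6 * (E.N - (n + 2)) + 19 * n + 13)
        ⟨0, ⟨s, 0, 0, 0, 0, 0, 0, 0, 0, 0, 0, 0, 0, 0⟩, M, []⟩
        ⟨46, ⟨s, n, E.N, bound n L, n + 1, 1, p, 0, d, 0, 0, t, x, i⟩, M', []⟩ := by
  have h₁ : n + 2 ≤ start n L (n + 1) := Nat.le_add_right _ _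
  have h₂ := hM.total
  have h₃ : (⟨9, ⟨s, n, E.N, E.N, n + 1, 1, 0, 0, E.N, 0, 0, 0, 0, n⟩, M, []⟩ : St) =
      ⟨9, ⟨s, n, E.N, bound n L + longs L (n + 1), n + 1, 1, 0, 0, start n L (n + 1), 0, 0, 0, 0,
        n⟩, M, []⟩ := by rw [bound_add, ← hN]
  obtain ⟨M₁, t, x, p, g₁, g₂⟩ := steps_pass1_loop (E := E) hL hN (s := s) n (t := 0) (x := 0)
    (p := 0) le_rfl ⟨hM.zero, hM.total, hM.table, hM.list, fun u h h' => by omega,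
      fun u h h' => by omega⟩
  obtain ⟨M₂, t', k₁, k₂⟩ := steps_pass2_loop (E := E) hL hN (s := s) (b := bound n L) (p := p)
    (x := x) n (v := 0) (t := t) (zero_add n) ⟨g₁.zero, g₁.total, fun u h h' => by omega,
      fun u h h' => by omega, g₁.moved, g₁.table'⟩
  rw [zero_add, ones_one hL] at k₂
  rw [← h₃, ← hN] at g₂
  exact ⟨M₂, t', p, _, x, _, k₁, .mono (.const rfl (show 1 ≤ E.N by omega) <|
    .load rfl (show 0 < E.N by omega) hM.zero (by omega) <|
    .add rfl rfl (show n + 1 ≤ E.N by omega) <|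
    .load rfl (show n + 1 < E.N by omega) rfl (show M (n + 1) ≤ E.N by omega) <|
    .add rfl rfl (show M (n + 1) + (n + 1) ≤ E.N by omega) <|
    .add rfl (show M (n + 1) + (n + 1) + 1 = E.N by omega) le_rfl <|
    .copy rfl le_rfl <| .copy rfl le_rfl <| .copy rfl (show n ≤ E.N by omega) <|
    g₂.trans <| .add rfl rfl (show n + 1 + 1 ≤ E.N by omega) k₂) (by omega)⟩

end Forward

/-! ### The passes after the search -/

section Restore

variable {E : Env} {n : ℕ} {L : ℕ → List ℕ}

/-- The memory after the search, and during the first pass of the restoration when the vertices up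
to `v` have been treated: a visited vertex `u` is marked by `min (L u).length 2`. -/
structure Back1 (n : ℕ) (L : ℕ → List ℕ) (v : ℕ) (M : ℕ → ℕ) : Prop where
  zero : M 0 = n
  total : M (n + 1) + (n + 2) = start n L (n + 1)
  list : ∀ u, 1 ≤ u → u ≤ n → Holds M (target n L u) (swapLast (L u))
  mark : ∀ u, v < u → u ≤ n → M u = target n L u ∨ M u = min (L u).length 2
  moved : ∀ u, 1 ≤ u → u ≤ v → Moved n L M u
  long : ∀ u, 1 ≤ u → u ≤ v → 2 ≤ (L u).length → M u = n + 1

theorem Back1.step {v : ℕ} {M : ℕ → ℕ} (hM : Back1 n L v M) (hv : v < n) {a : ℕ}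
    (h₀ : (L (v + 1)).length = 0 → a = start n L (n + 1))
    (h₁ : ∀ h : (L (v + 1)).length = 1, a = (L (v + 1))[0])
    (h₂ : 2 ≤ (L (v + 1)).length → a = n + 1) :
    Back1 n L (v + 1) (Function.update M (v + 1) a) := by
  have hb : bound n L = n + 2 + ones L (n + 1) := rfl
  have hH (u : ℕ) (h : 1 ≤ u) (h' : u ≤ n) :
      Holds (Function.update M (v + 1) a) (target n L u) (swapLast (L u)) := by
    intro j hj
    have : n + 2 ≤ target n L u := by
      rw [length_swapLast] at hj
      rw [target, if_neg (by omega)]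
      split_ifs <;> omega
    rw [Function.update_of_ne (by omega), hM.list u h h' j hj]
  refine ⟨by rw [Function.update_of_ne (by omega), hM.zero],
    by rw [Function.update_of_ne (by omega), hM.total], hH,
    fun u h h' => by rw [Function.update_of_ne (by omega)]; exact hM.mark u (by omega) h',
    fun u h h' => ?_, fun u h h' hd => ?_⟩
  · rcases eq_or_ne u (v + 1) with rfl | hne
    · refine ⟨fun h => by rw [Function.update_self, h₀ h],
        fun h => by rw [Function.update_self, h₁ h], fun hd => ?_⟩
      have := hH (v + 1) h (by omega)
      rwa [target, if_neg (by omega), if_neg (by omega)] at this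
    · obtain ⟨m₀, m₁, m₂⟩ := hM.moved u h (by omega)
      refine ⟨fun h => by rw [Function.update_of_ne hne, m₀ h],
        fun h => by rw [Function.update_of_ne hne, m₁ h], fun hd j hj => ?_⟩
      rw [Function.update_of_ne (by omega), m₂ hd j hj]
  · rcases eq_or_ne u (v + 1) with rfl | hne
    · rw [Function.update_self, h₂ hd]
    · rw [Function.update_of_ne hne, hM.long u h (by omega) hd]

/-- One iteration of the first pass of the restoration. -/
theorem steps_back1 (hL : SortedLists n L) (hN : E.N = start n L (n + 1)) {v : ℕ} (hv : v < n)
    {c r f t x : ℕ} {M : ℕ → ℕ} {τ : List Call} (hM : Back1 n L v M) :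
    ∃ M' t' x', Back1 n L (v + 1) M' ∧ Steps E 11
      ⟨123, ⟨c, n, E.N, bound n L, n + 1, 1, 0, r, n + 2 + ones L (v + 1), f, 2, t, x, v⟩, M, τ⟩
      ⟨123, ⟨c, n, E.N, bound n L, n + 1, 1, 0, r, n + 2 + ones L (v + 2), f, 2, t', x', v + 1⟩,
        M', τ⟩ := by
  have h₁ := ones_mono (L := L) (u := v + 1 + 1) (v := n + 1) (by omega)
  have h₂ := longs_mono (L := L) (u := v + 1 + 1) (v := n + 1) (by omega)
  have h₃ := bound_add n L
  have ho := ones_succ (L := L) (v + 1)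
  have hl := longs_succ (L := L) (v + 1)
  have hb : bound n L = n + 2 + ones L (n + 1) := rfl
  have hm := hM.mark (v + 1) (by omega) hv
  have e : v + 1 + 1 = v + 2 := rfl
  rw [e] at h₁ ho hl h₂
  have hs (k : ℕ) (c' : St) (hx : M (v + 1) ≤ E.N) (h : Steps E k ⟨126, ⟨c, n, E.N, bound n L,
      n + 1, 1, 0, r, n + 2 + ones L (v + 1), f, 2, M (v + 1), x, v + 1⟩, M, τ⟩ c') :
      Steps E (k + 3)
      ⟨123, ⟨c, n, E.N, bound n L, n + 1, 1, 0, r, n + 2 + ones L (v + 1), f, 2, t, x, v⟩, M, τ⟩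
      c' :=
    .add rfl rfl (show v + 1 ≤ E.N by omega) <| .not_lt rfl hv <|
      .load rfl (show v + 1 < E.N by omega) rfl hx h
  rw [ho]
  rcases Nat.lt_trichotomy (L (v + 1)).length 1 with hd | hd | hd
  · have ht : target n L (v + 1) = E.N := by rw [target, if_pos (by omega), hN]
    rw [if_neg (by omega)]
    refine ⟨_, M (v + 1), x, hM.step hv (a := E.N) (fun _ => hN) (fun h => by omega)
      (fun h => by omega), ?_⟩
    rw [ht, show min (L (v + 1)).length 2 = 0 by omega] at hm
    refine .mono (hs 4 _ (by omega) ?_) (by omega)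
    rcases hm with hm | hm
    · exact .mono (.eq rfl hm <| .store rfl (show v + 1 < E.N by omega) <| .jump rfl <| .refl _)
        (by omega)
    · exact .ne rfl (show M (v + 1) ≠ E.N by omega) <| .eq rfl hm <|
        .store rfl (show v + 1 < E.N by omega) <| .jump rfl <| .refl _
  · have ht : target n L (v + 1) = n + 2 + ones L (v + 1) := by
      rw [target, if_neg (by omega), if_pos hd]
    have hx := hL.le (v + 1) _ (List.getElem_mem (l := L (v + 1)) (n := 0) (by omega))
    have hH : M (n + 2 + ones L (v + 1)) = (L (v + 1))[0] := by
      have h1 : swapLast (L (v + 1)) = L (v + 1) := by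
        obtain ⟨y, hy⟩ := List.length_eq_one_iff.1 hd
        rw [hy]; rfl
      have := hM.list (v + 1) (by omega) hv
      rw [h1, ht] at this
      exact this 0 (by omega)
    rw [if_pos hd] at ho ⊢
    rw [ht, show min (L (v + 1)).length 2 = 1 by omega] at hm
    exact ⟨_, M (v + 1), (L (v + 1))[0], hM.step hv (a := (L (v + 1))[0]) (fun h => by omega)
      (fun _ => rfl) (fun h => by omega), hs 8 _ (by omega) <|
        .ne rfl (show M (v + 1) ≠ E.N by omega) <| .ne rfl (show M (v + 1) ≠ 0 by omega) <|
        .ne rfl (show M (v + 1) ≠ 2 by omega) <| .lt rfl (show M (v + 1) < bound n L by omega) <|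
        .load rfl (show n + 2 + ones L (v + 1) < E.N by omega) hH (by omega) <|
        .store rfl (show v + 1 < E.N by omega) <|
        .add rfl rfl (show n + 2 + ones L (v + 1) + 1 ≤ E.N by omega) <| .jump rfl <| .refl _⟩
  · have ht : target n L (v + 1) = bound n L + longs L (v + 1) := by
      rw [target, if_neg (by omega), if_neg (by omega)]
    rw [if_neg (by omega)]
    rw [if_pos (by omega)] at hl
    rw [ht, show min (L (v + 1)).length 2 = 2 by omega] at hm
    refine ⟨_, M (v + 1), x, hM.step hv (a := n + 1) (fun h => by omega)
      (fun h => by omega) (fun _ => rfl), ?_⟩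
    refine .mono (hs 6 _ (by omega) ?_) (by omega)
    refine .ne rfl (show M (v + 1) ≠ E.N by omega) <| .ne rfl (show M (v + 1) ≠ 0 by omega) ?_
    rcases hm with hm | hm
    · exact .ne rfl (show M (v + 1) ≠ 2 by omega) <|
        .not_lt rfl (show bound n L ≤ M (v + 1) by omega) <|
        .store rfl (show v + 1 < E.N by omega) <| .jump rfl <| .refl _
    · exact .mono (.eq rfl hm <| .store rfl (show v + 1 < E.N by omega) <| .jump rfl <| .refl _)
        (by omega)

/-- Move a list of length at least 2 back to the left, from left to right, when `j` words have been
moved. The end of the list is recognized by the descent. -/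
theorem steps_copyUp {p q : ℕ} (hpq : p ≤ q) {l : List ℕ} (hl : l.Pairwise (· < ·))
    {a b c d e f g h i : ℕ} {τ : List Call} (hq : q + l.length ≤ E.N) (hlN : ∀ y ∈ l, y ≤ E.N)
    (m : ℕ) : ∀ {j : ℕ} {M : ℕ → ℕ} {t x : ℕ}, j + (m + 2) = l.length →
      (∀ k (_ : k < j) (hk : k < l.length), M (p + k) = l[k]) →
      (∀ k (hk : k < (swapLast l).length), j ≤ k → M (q + k) = (swapLast l)[k]) →
    ∃ M' t' x', Holds M' p l ∧ (∀ z, z < p ∨ p + l.length ≤ z → M' z = M z) ∧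
      Steps E (7 * m + 10) ⟨149, ⟨a, b, c, q + j, d, 1, e, f, p + j, g, h, t, x, i⟩, M, τ⟩
        ⟨140, ⟨a, b, c, q + l.length, d, 1, e, f, p + l.length, g, h, t', x', i⟩, M', τ⟩ := by
  have hlt (k : ℕ) (hk : k < (swapLast l).length) : (swapLast l)[k] ≤ E.N :=
    hlN _ ((swapLast_perm l).mem_iff.1 (List.getElem_mem hk))
  have hlen := length_swapLast l
  induction m with
  | zero =>
    intro j M t x hj h₁ h₂
    have g₁ := h₂ j (by omega) le_rfl
    have g₂ := h₂ (j + 1) (by omega) (by omega)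
    have hd := (swapLast_descent hl (j := j) (by omega)).2 (by omega)
    refine ⟨Function.update (Function.update M (p + j) (swapLast l)[j + 1]) (p + j + 1)
      (swapLast l)[j], (swapLast l)[j + 1], (swapLast l)[j], fun k hk => ?_, fun z hz => ?_, ?_⟩
    · rcases lt_trichotomy k j with hkj | rfl | hkj
      · rw [Function.update_of_ne (by omega), Function.update_of_ne (by omega), h₁ k hkj hk]
      · rw [Function.update_of_ne (by omega), Function.update_self,
          swapLast_getElem_snd l (by omega)]
      · obtain rfl : k = j + 1 := by omega
        rw [← add_assoc, Function.update_self, swapLast_getElem_fst l (by omega)]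
    · rw [Function.update_of_ne (by omega), Function.update_of_ne (by omega)]
    · rw [show q + l.length = q + j + 1 + 1 by omega, show p + l.length = p + j + 1 + 1 by omega]
      exact .load rfl (show q + j < E.N by omega) g₁ (hlt _ _) <|
        .add rfl rfl (show q + j + 1 ≤ E.N by omega) <|
        .load rfl (show q + j + 1 < E.N by omega) g₂ (hlt _ _) <| .lt rfl hd <|
        .store rfl (show p + j < E.N by omega) <| .add rfl rfl (show p + j + 1 ≤ E.N by omega) <|
        .store rfl (show p + j + 1 < E.N by omega) <|
        .add rfl rfl (show p + j + 1 + 1 ≤ E.N by omega) <|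
        .add rfl rfl (show q + j + 1 + 1 ≤ E.N by omega) <| .jump rfl <| .refl _
  | succ m ih =>
    intro j M t x hj h₁ h₂
    have g₁ := h₂ j (by omega) le_rfl
    have g₂ := h₂ (j + 1) (by omega) (by omega)
    have hd := mt (swapLast_descent hl (j := j) (by omega)).1 (by omega)
    obtain ⟨M', t', x', k₁, k₂, k₃⟩ := ih (j := j + 1)
      (M := Function.update M (p + j) (swapLast l)[j]) (t := (swapLast l)[j + 1])
      (x := (swapLast l)[j]) (by omega)
      (fun k hk hk' => by
        rcases eq_or_ne k j with rfl | hne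
        · rw [Function.update_self, swapLast_getElem l (by omega)]
        · rw [Function.update_of_ne (by omega), h₁ k (by omega) hk'])
      (fun k hk hk' => by rw [Function.update_of_ne (by omega), h₂ k hk (by omega)])
    exact ⟨M', t', x', k₁, fun z hz => by rw [k₂ z hz, Function.update_of_ne (by omega)],
      .mono (.load rfl (show q + j < E.N by omega) g₁ (hlt _ _) <|
        .add rfl rfl (show q + j + 1 ≤ E.N by omega) <|
        .load rfl (show q + j + 1 < E.N by omega) g₂ (hlt _ _) <| .not_lt rfl (not_lt.1 hd) <|
        .store rfl (show p + j < E.N by omega) <| .add rfl rfl (show p + j + 1 ≤ E.N by omega) <|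
        .jump rfl k₃) (by omega)⟩

/-- The state of the second pass of the restoration when the vertices up to `v` have been
treated. -/
structure Back2 (n : ℕ) (L : ℕ → List ℕ) (v : ℕ) (M : ℕ → ℕ) : Prop where
  zero : M 0 = n
  total : M (n + 1) + (n + 2) = start n L (n + 1)
  table : ∀ u, 1 ≤ u → u ≤ v → M u = start n L u
  list : ∀ u, 1 ≤ u → u ≤ v → Holds M (start n L u) (L u)
  moved : ∀ u, v < u → u ≤ n → Moved n L M u
  long : ∀ u, v < u → u ≤ n → 2 ≤ (L u).length → M u = n + 1

/-- One iteration of the second pass of the restoration. -/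
theorem steps_back2 (hL : SortedLists n L) (hN : E.N = start n L (n + 1)) {v : ℕ} (hv : v < n)
    {c p r f d t x : ℕ} {M : ℕ → ℕ} {τ : List Call} (hM : Back2 n L v M) :
    ∃ M' t' x', Back2 n L (v + 1) M' ∧ Steps E (7 * (L (v + 1)).length + 9)
      ⟨140, ⟨c, n, E.N, bound n L + longs L (v + 1), n + 1, 1, p, r, start n L (v + 1), f, d, t, x,
        v⟩, M, τ⟩
      ⟨140, ⟨c, n, E.N, bound n L + longs L (v + 2), n + 1, 1, p, r, start n L (v + 2), f, d, t',
        x', v + 1⟩, M', τ⟩ := by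
  have h₁ := start_mono (n := n) (L := L) (u := v + 1 + 1) (v := n + 1) (by omega)
  have h₂ := longs_mono (L := L) (u := v + 1 + 1) (v := n + 1) (by omega)
  have h₃ := bound_add n L
  have h₄ := start_le (n := n) (L := L) (v := v + 1) (by omega)
  have h₅ := start_le (n := n) (L := L) (v := v + 1 + 1) (by omega)
  have hb : n + 2 ≤ bound n L := Nat.le_add_right _ _
  have hs := start_succ (n := n) (L := L) (v + 1)
  have hl := longs_succ (L := L) (v + 1)
  have h0 : n + 2 ≤ start n L (v + 1) := Nat.le_add_right _ _
  obtain ⟨m₀, m₁, m₂⟩ := hM.moved (v + 1) (by omega) hv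
  have e : v + 1 + 1 = v + 2 := rfl
  rw [e] at h₁ h₂ h₅ hs hl
  -- a common form of the new state
  have key (M' : ℕ → ℕ) (ht : M' (v + 1) = start n L (v + 1))
      (hH : Holds M' (start n L (v + 1)) (L (v + 1)))
      (hk : ∀ z, z < start n L (v + 1) ∨ start n L (v + 2) ≤ z → z ≠ v + 1 → M' z = M z) :
      Back2 n L (v + 1) M' := by
    have hMz (z : ℕ) (hz : z ≤ n + 1) (hz' : z ≠ v + 1) : M' z = M z := hk z (by omega) hz'
    refine ⟨by rw [hMz 0 (by omega) (by omega), hM.zero],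
      by rw [hMz (n + 1) (by omega) (by omega), hM.total],
      fun u hu hu' => ?_, fun u hu hu' => ?_, fun u hu hu' => ?_, fun u hu hu' hd => ?_⟩
    · rcases eq_or_ne u (v + 1) with rfl | hne
      · exact ht
      · rw [hMz u (by omega) hne, hM.table u hu (by omega)]
    · rcases eq_or_ne u (v + 1) with rfl | hne
      · exact hH
      · intro j hj
        have := start_mono (n := n) (L := L) (u := u + 1) (v := v + 1) (by omega)
        have := start_succ (n := n) (L := L) u
        have : n + 2 ≤ start n L u := Nat.le_add_right _ _
        rw [hk _ (by omega) (by omega), hM.list u hu (by omega) j hj]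
    · obtain ⟨m₀, m₁, m₂⟩ := hM.moved u (by omega) hu'
      have := hMz u (by omega) (by omega)
      have hlu := longs_mono (L := L) (u := v + 2) (v := u) (by omega)
      refine ⟨fun h => this ▸ m₀ h, fun h => this ▸ m₁ h, fun h j hj => ?_⟩
      rw [hk _ (by omega) (by omega), m₂ h j hj]
    · rw [hMz u (by omega) (by omega), hM.long u (by omega) hu' hd]
  set M₁ := Function.update M (v + 1) (start n L (v + 1)) with hM₁
  have hne (z : ℕ) (hz : z ≠ v + 1) : M₁ z = M z := Function.update_of_ne hz _ _
  have hrun (k : ℕ) (c' : St) (hx : M (v + 1) ≤ E.N) (h : Steps E k ⟨144, ⟨c, n, E.N,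
      bound n L + longs L (v + 1), n + 1, 1, p, r, start n L (v + 1), f, d, M (v + 1), x, v + 1⟩,
      M₁, τ⟩ c') : Steps E (k + 4)
      ⟨140, ⟨c, n, E.N, bound n L + longs L (v + 1), n + 1, 1, p, r, start n L (v + 1), f, d, t, x,
        v⟩, M, τ⟩ c' :=
    .add rfl rfl (show v + 1 ≤ E.N by omega) <| .not_lt rfl hv <|
      .load rfl (show v + 1 < E.N by omega) rfl hx <| .store rfl (show v + 1 < E.N by omega) h
  rw [hs, hl]
  rcases Nat.lt_trichotomy (L (v + 1)).length 1 with hd | hd | hd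
  · rw [if_neg (by omega), show (L (v + 1)).length = 0 by omega]
    have hm : M (v + 1) = E.N := by rw [m₀ (by omega), hN]
    exact ⟨M₁, M (v + 1), x, key _ (Function.update_self _ _ _) (fun j hj => by omega)
      (fun z _ hz => hne z hz),
      .mono (hrun 1 _ (by omega) <| .eq rfl hm <| .refl _) (by omega)⟩
  · rw [if_neg (by omega), hd]
    have hm := m₁ hd
    have hx := hL.le (v + 1) _ (List.getElem_mem (l := L (v + 1)) (n := 0) (by omega))
    refine ⟨Function.update M₁ (start n L (v + 1)) (M (v + 1)), M (v + 1), x, key _ ?_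
      (fun j hj => ?_) (fun z hz hz' => ?_),
      .mono (hrun 5 _ (by omega) <| .ne rfl (show M (v + 1) ≠ E.N by omega) <|
        .ne rfl (show M (v + 1) ≠ n + 1 by omega) <|
        .store rfl (show start n L (v + 1) < E.N by omega) <|
        .add rfl rfl (show start n L (v + 1) + 1 ≤ E.N by omega) <| .jump rfl <| .refl _)
        (by omega)⟩
    · rw [Function.update_of_ne (by omega), hM₁, Function.update_self]
    · obtain rfl : j = 0 := by omega
      exact (Function.update_self _ _ _).trans hm
    · rw [Function.update_of_ne (by omega), hne z hz']
  · rw [if_pos (by omega)] at hl ⊢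
    rw [← Nat.add_assoc]
    have hm := hM.long (v + 1) (by omega) hv hd
    obtain ⟨m, hm'⟩ : ∃ m, (L (v + 1)).length = m + 2 := ⟨_, (Nat.sub_add_cancel hd).symm⟩
    obtain ⟨M', t', x', g₁, g₂, g₃⟩ := steps_copyUp (E := E) h₄ (hL.sorted (v + 1)) (a := c)
      (b := n) (c := E.N) (d := n + 1) (e := p) (f := r) (g := f) (h := d) (i := v + 1) (τ := τ)
      (t := M (v + 1)) (x := x) (M := M₁) (by omega) (fun y hy => by have := hL.le _ y hy; omega) m
      (j := 0) (by omega) (fun k hk => by omega)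
      (fun k hk _ => by rw [hne _ (by omega), m₂ hd k hk])
    exact ⟨M', t', x', key _ (by rw [g₂ _ (by omega), hM₁, Function.update_self]) g₁
      (fun z hz hz' => by rw [g₂ _ (by omega), hne z hz']),
      .mono (hrun _ _ (by omega) <| .ne rfl (show M (v + 1) ≠ E.N by omega) <|
        .eq rfl hm g₃) (by omega)⟩

/-- The first pass of the restoration as a whole. -/
theorem steps_back1_loop (hL : SortedLists n L) (hN : E.N = start n L (n + 1)) {c r f : ℕ}
    {τ : List Call} (m : ℕ) : ∀ {v t x : ℕ} {M : ℕ → ℕ}, v + m = n → Back1 n L v M →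
    ∃ M' t' x', Back1 n L n M' ∧ Steps E (11 * m + 2)
      ⟨123, ⟨c, n, E.N, bound n L, n + 1, 1, 0, r, n + 2 + ones L (v + 1), f, 2, t, x, v⟩, M, τ⟩
      ⟨138, ⟨c, n, E.N, bound n L, n + 1, 1, 0, r, n + 2 + ones L (n + 1), f, 2, t', x', n + 1⟩,
        M', τ⟩ := by
  have : n + 2 ≤ start n L (n + 1) := Nat.le_add_right _ _
  induction m with
  | zero =>
    rintro v t x M rfl hM
    exact ⟨M, t, x, hM, .add rfl rfl (show v + 1 ≤ E.N by omega) <| .lt rfl (Nat.lt_succ_self v) <|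
      .refl _⟩
  | succ m ih =>
    intro v t x M hv hM
    obtain ⟨M₁, t, x, g₁, g₂⟩ := steps_back1 (E := E) hL hN (by omega) (c := c) (r := r) (f := f)
      (t := t) (x := x) (τ := τ) hM
    obtain ⟨M', t', x', h₁, h₂⟩ := ih (t := t) (x := x) (by omega) g₁
    exact ⟨M', t', x', h₁, (g₂.trans h₂).mono (by omega)⟩

/-- The second pass of the restoration as a whole. -/
theorem steps_back2_loop (hL : SortedLists n L) (hN : E.N = start n L (n + 1)) {c p r f d : ℕ}
    {τ : List Call} (m : ℕ) : ∀ {v t x : ℕ} {M : ℕ → ℕ}, v + m = n → Back2 n L v M →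
    ∃ M' R, IsInput n L M' ∧ Steps E (7 * (E.N - start n L (v + 1)) + 9 * m + 2)
      ⟨140, ⟨c, n, E.N, bound n L + longs L (v + 1), n + 1, 1, p, r, start n L (v + 1), f, d, t, x,
        v⟩, M, τ⟩ ⟨162, R, M', τ⟩ := by
  have : n + 2 ≤ start n L (n + 1) := Nat.le_add_right _ _
  induction m with
  | zero =>
    rintro v t x M rfl hM
    exact ⟨M, _, ⟨hM.zero, hM.total, hM.table, hM.list⟩,
      .mono (.add rfl rfl (show v + 1 ≤ E.N by omega) <| .lt rfl (Nat.lt_succ_self v) <|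
      .refl _) (by omega)⟩
  | succ m ih =>
    intro v t x M hv hM
    obtain ⟨M₁, t, x, g₁, g₂⟩ := steps_back2 (E := E) hL hN (by omega) (c := c) (p := p) (r := r)
      (f := f) (d := d) (t := t) (x := x) (τ := τ) hM
    obtain ⟨M', R, h₁, h₂⟩ := ih (t := t) (x := x) (by omega) g₁
    refine ⟨M', R, h₁, (g₂.trans h₂).mono ?_⟩
    have := start_succ (n := n) (L := L) (v + 1)
    have := start_mono (n := n) (L := L) (u := v + 1 + 1) (v := n + 1) (by omega)
    omega

/-- The restoration as a whole. -/
theorem steps_restore (hL : SortedLists n L) (hN : E.N = start n L (n + 1)) (hn : 0 < n)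
    {c p r s f d t x i : ℕ} {M : ℕ → ℕ} {τ : List Call} (hM : Back1 n L 0 M) :
    ∃ M' R, IsInput n L M' ∧ Steps E (7 * (E.N - (n + 2)) + 20 * n + 10)
      ⟨119, ⟨c, n, E.N, bound n L, n + 1, 1, p, r, s, f, d, t, x, i⟩, M, τ⟩ ⟨162, R, M', τ⟩ := by
  have : n + 2 ≤ start n L (n + 1) := Nat.le_add_right _ _
  obtain ⟨M₁, t₁, x₁, g₁, g₂⟩ := steps_back1_loop (E := E) hL hN (c := c) (r := r) (f := f) (τ := τ)
    n (v := 0) (t := t) (x := x) (zero_add n) hM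
  obtain ⟨M', R, h₁, h₂⟩ := steps_back2_loop (E := E) hL hN (c := c) (p := 0) (r := r) (f := f)
    (d := 2) (τ := τ) n (v := 0) (t := t₁) (x := x₁) (M := M₁) (zero_add n)
    ⟨g₁.zero, g₁.total, fun u h h' => by omega, fun u h h' => by omega,
      fun u h h' => g₁.moved u h h', fun u h h' => g₁.long u h h'⟩
  rw [zero_add, ones_one hL, Nat.add_zero] at g₂
  rw [zero_add, longs_one hL, start_one hL, Nat.add_zero] at h₂
  exact ⟨M', R, h₁, .mono (.const rfl (Nat.zero_le _) <| .const rfl (Nat.zero_le _) <|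
    .const rfl (show 2 ≤ E.N by omega) <| .add rfl rfl (show n + 1 + 1 ≤ E.N by omega) <|
    g₂.trans <| .const rfl (Nat.zero_le _) <| .add rfl rfl (show n + 1 + 1 ≤ E.N by omega) <| h₂)
    (by omega)⟩

end Restore

/-! ### The sorted standard representation -/

section Representation

variable {n : ℕ} {L : ℕ → List ℕ}

/-- The lists of the vertices `1, …, v` one after the other. -/
def flat (L : ℕ → List ℕ) (v : ℕ) : List ℕ := (List.range v).flatMap fun k => L (k + 1)

/-- The array in which the lists of the vertices `1, …, n` are represented, up to the list of
`v`. -/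
def rep (n : ℕ) (L : ℕ → List ℕ) (v : ℕ) : List ℕ :=
  n :: (List.range n).map (fun k => start n L (k + 1)) ++ (start n L (n + 1) - (n + 2)) :: flat L v

theorem flat_succ (v : ℕ) : flat L (v + 1) = flat L v ++ L (v + 1) := by
  simp [flat, List.range_succ]

theorem rep_succ (v : ℕ) : rep n L (v + 1) = rep n L v ++ L (v + 1) := by
  simp [rep, flat_succ]

theorem length_rep (hL : SortedLists n L) (v : ℕ) : (rep n L v).length = start n L (v + 1) := by
  induction v with
  | zero => rw [zero_add, start_one hL]; simp [rep, flat]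
  | succ v ih => rw [rep_succ, List.length_append, ih, ← start_succ]

theorem rep_prefix {u v : ℕ} (h : u ≤ v) : rep n L u <+: rep n L v := by
  induction v, h using Nat.le_induction with
  | base => exact List.prefix_rfl
  | succ v _ ih => exact ih.trans (rep_succ (n := n) (L := L) v ▸ List.prefix_append _ _)

theorem isInput_rep (hL : SortedLists n L) : IsInput n L fun x => (rep n L n).getD x 0 := by
  have hN : n + 2 ≤ start n L (n + 1) := Nat.le_add_right _ _
  refine ⟨rfl, ?_, fun u hu hu' => ?_, fun u hu hu' j hj => ?_⟩
  · have : (rep n L n).getD (n + 1) 0 = start n L (n + 1) - (n + 2) := by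
      simp [rep, List.getD_eq_getElem?_getD]
    change (rep n L n).getD (n + 1) 0 + _ = _
    omega
  · obtain ⟨u, rfl⟩ := Nat.exists_eq_add_of_le' hu
    have : u < ((List.range n).map fun k => start n L (k + 1)).length := by simpa using hu'
    change (_ ++ _ : List ℕ).getD u 0 = _
    rw [List.getD_eq_getElem?_getD, List.getElem?_append_left this]
    simp [List.getElem?_range (show u < n from hu')]
  · obtain ⟨u, rfl⟩ := Nat.exists_eq_add_of_le' hu
    obtain ⟨r, hr⟩ := rep_prefix (n := n) (L := L) hu'
    rw [← hr, rep_succ, List.append_assoc, List.getD_eq_getElem?_getD,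
      List.getElem?_append_right (by rw [length_rep hL]; omega), length_rep hL,
      Nat.add_sub_cancel_left, List.getElem?_append_left hj, List.getElem?_eq_getElem hj,
      Option.getD_some]

/-- The memory is determined by its being the input. -/
theorem IsInput.eq_rep (hL : SortedLists n L) {M : ℕ → ℕ} (hM : IsInput n L M) (v : ℕ)
    (hv : v ≤ n) : (List.range (start n L (v + 1))).map M = rep n L v := by
  induction v with
  | zero =>
    have hT : (List.range n).map (fun k => M (k + 1)) =
        (List.range n).map fun k => start n L (k + 1) :=
      List.map_congr_left fun k hk => hM.table (k + 1) (by omega) (List.mem_range.1 hk)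
    have := hM.total
    rw [zero_add, start_one hL, List.range_succ, List.range_succ_eq_map]
    simp [rep, flat, hM.zero, ← hT, ← this, Function.comp_def]
  | succ v ih =>
    rw [start_succ, List.range_add, List.map_append, ih (by omega), rep_succ]
    congr 1
    refine List.ext_getElem (by simp) fun j hj hj' => ?_
    simpa using hM.list (v + 1) (by omega) hv j hj'

end Representation

section Digraph

variable {n : ℕ} (G : Digraph (Fin n))

/-- The adjacency arrays of `G` as lists of numbers. -/
noncomputable def nameLists (u : ℕ) : List ℕ :=
  if h : u - 1 < n ∧ 0 < u then (adjArray G ⟨u - 1, h.1⟩).map name else []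

theorem nameLists_zero : nameLists G 0 = [] := dif_neg (by omega)

theorem nameLists_name (v : Fin n) : nameLists G (name v) = (adjArray G v).map name := by
  rw [nameLists, dif_pos ⟨by simp [name], name_pos v⟩]
  rfl

theorem length_nameLists (v : Fin n) : (nameLists G (name v)).length = (adjArray G v).length := by
  rw [nameLists_name, List.length_map]

theorem adjArray_pairwise (u : Fin n) : (adjArray G u).Pairwise (· < ·) :=
  (List.pairwise_lt_finRange n).filter _

theorem sortedLists_nameLists : SortedLists n (nameLists G) := by
  refine ⟨nameLists_zero G, fun u => ?_, fun u x hx => ?_⟩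
  · rw [nameLists]
    split_ifs
    · exact (adjArray_pairwise G _).map _ fun a b h => Nat.succ_lt_succ h
    · exact .nil
  · rw [nameLists] at hx
    split_ifs at hx
    · obtain ⟨v, _, rfl⟩ := List.mem_map.1 hx
      exact name_le v
    · simp at hx

theorem start_nameLists (v : Fin n) : start n (nameLists G) (v + 1) = beginPos G v := by
  rw [start, beginPos, Finset.sum_range_succ']
  have : ∑ k ∈ Finset.range v, (nameLists G (k + 1)).length =
      ∑ u ∈ Finset.Iio v, (adjArray G u).length := by
    refine (Finset.sum_nbij' (fun u : Fin n => (u : ℕ)) (fun k => if h : k < n then ⟨k, h⟩ else v)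
      (fun u hu => ?_) (fun k hk => ?_) (fun u _ => ?_) (fun k hk => ?_) fun u _ => ?_).symm
    · simpa using hu
    · have hk := Finset.mem_range.1 hk
      rw [dif_pos (hk.trans v.2)]
      simpa [Fin.lt_def] using hk
    · simp
    · rw [dif_pos ((Finset.mem_range.1 hk).trans v.2)]
    · exact (length_nameLists G u).symm
  rw [this, nameLists_zero]
  rfl

theorem start_last : start n (nameLists G) (n + 1) = n + 2 + ∑ u, (adjArray G u).length := by
  rw [start, Finset.sum_range_succ', Finset.sum_range, nameLists_zero, List.length_nil, add_zero]
  exact congrArg _ (Finset.sum_congr rfl fun u _ => length_nameLists G u)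

theorem sortedRep_eq : sortedRep G = rep n (nameLists G) n := by
  rw [sortedRep, rep, start_last, Nat.add_sub_cancel_left, flat, ← List.map_coe_finRange_eq_range,
    List.map_map, List.flatMap_map]
  simp only [Function.comp_def, start_nameLists]
  congr 3
  exact funext fun u => (nameLists_name G u).symm

theorem length_sortedRep : (sortedRep G).length = n + 2 + ∑ u, (adjArray G u).length := by
  rw [sortedRep_eq, length_rep (sortedLists_nameLists G), start_last]

theorem length_adjArray (u : Fin n) [DecidablePred (G.Adj u)] :
    (adjArray G u).length = (Finset.univ.filter (G.Adj u)).card := by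
  rw [adjArray, ← List.toFinset_card_of_nodup ((List.nodup_finRange n).filter _)]
  congr 1
  ext v
  simp

open Classical in
theorem sum_length_adjArray : ∑ u, (adjArray G u).length = numArcs G := by
  rw [numArcs, Set.ncard_eq_toFinset_card', Set.toFinset_ofPred, Finset.card_filter,
    Fintype.sum_prod_type]
  exact Finset.sum_congr rfl fun u _ => (length_adjArray G u).trans (Finset.card_filter _ _)

open Classical in
theorem sum_length_bidirected (G : SimpleGraph (Fin n)) :
    ∑ u, (adjArray (bidirected G) u).length = 2 * G.edgeSet.ncard := by
  rw [Set.ncard_eq_toFinset_card', ← SimpleGraph.edgeFinset,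
    ← SimpleGraph.sum_degrees_eq_twice_card_edges]
  refine Finset.sum_congr rfl fun u _ => ?_
  rw [length_adjArray, ← SimpleGraph.card_neighborFinset_eq_degree]
  congr 1
  ext v
  rw [Finset.mem_filter, SimpleGraph.mem_neighborFinset]
  simp [bidirected]

end Digraph

/-! ### The algorithm as a whole -/

section Main

variable {n : ℕ} (G : Digraph (Fin n))

/-- After the rearrangement, the lists of two vertices do not overlap. -/
theorem target_add_ne {L : ℕ → List ℕ} {u v i j : ℕ} (h : u < v) (hv : v ≤ n)
    (hi : i < (L u).length) (hj : j < (L v).length) : target n L u + i ≠ target n L v + j := by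
  have h₁ := ones_mono (L := L) (u := u + 1) (v := v) h
  have h₂ := longs_mono (L := L) (u := u + 1) (v := v) h
  have h₃ := ones_mono (L := L) (u := v + 1) (v := n + 1) (by omega)
  have h₄ := ones_mono (L := L) (u := v) (v := v + 1) (by omega)
  rw [ones_succ] at h₁ h₃
  rw [longs_succ] at h₂
  have hb : bound n L = n + 2 + ones L (n + 1) := rfl
  rw [target, target]
  split_ifs at h₁ h₂ h₃ ⊢ <;> omega

/-- The rearrangement meets the requirements of the search. -/
theorem layout {N : ℕ} (hN : N = start n (nameLists G) (n + 1)) :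
    Layout N (bound n (nameLists G)) (fun v => target n (nameLists G) (name v))
      fun v => swapLast (adjArray G v) := by
  set L := nameLists G with hL
  have hlen (v : Fin n) : (swapLast (adjArray G v)).length = (L (name v)).length := by
    rw [hL, nameLists_name, length_swapLast, List.length_map]
  have hb : bound n L = n + 2 + ones L (n + 1) := rfl
  have h₁ := bound_add n L
  have ho (v : Fin n) := (ones_succ (name v)).symm.trans_le
    (ones_mono (L := L) (v := n + 1) (Nat.succ_le_succ (name_le v)))
  have hl (v : Fin n) := (longs_succ (name v)).symm.trans_le
    (longs_mono (L := L) (v := n + 1) (Nat.succ_le_succ (name_le v)))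
  refine ⟨by omega, by omega, fun v => ?_, fun v => ?_, fun v h => ?_, fun v h => ?_, fun v h => ?_,
    fun u v i j huv hi hj => ?_, fun v j h => ?_⟩
  · rw [target]
    split_ifs <;> omega
  · have h₂ := ho v
    have h₃ := hl v
    rw [hlen, target]
    split_ifs at h₂ h₃ ⊢ <;> omega
  · rw [hlen] at h
    rw [target, if_pos h, hN]
  · rw [hlen] at h
    have := ho v
    rw [if_pos h] at this
    rw [target, if_neg (by omega), if_pos h]
    omega
  · rw [hlen] at h
    rw [target, if_neg (by omega), if_neg (by omega)]
    omega
  · rw [hlen] at hi hj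
    rcases Nat.lt_or_gt_of_ne (mt name_inj.1 huv) with h | h
    · exact target_add_ne h (name_le v) hi hj
    · exact (target_add_ne h (name_le u) hj hi).symm
  · rw [swapLast_descent (adjArray_pairwise G v), length_swapLast]

theorem exists_name {u : ℕ} (h : 1 ≤ u) (h' : u ≤ n) : ∃ v : Fin n, name v = u :=
  ⟨⟨u - 1, by omega⟩, Nat.sub_add_cancel h⟩

/-- The rearranged memory is what the search starts from. -/
theorem Pass2.intact {M : ℕ → ℕ} (hM : Pass2 n (nameLists G) n M) (v : Fin n) :
    Intact (fun v => target n (nameLists G) (name v)) (fun v => swapLast (adjArray G v)) M v := by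
  refine ⟨hM.table _ (name_pos v) (name_le v), fun j hj => ?_⟩
  have := hM.list _ (name_pos v) (name_le v)
  rw [nameLists_name, ← map_swapLast] at this
  exact (this j (by simpa using hj)).trans (List.getElem_map _)

/-- The memory that the search leaves behind is what the restoration starts from. -/
theorem Painted.back1 {M M' : ℕ → ℕ} {W : Finset (Fin n)} (hM : Pass2 n (nameLists G) n M)
    (h : Painted (fun v => swapLast (adjArray G v)) M ∅ W M') : Back1 n (nameLists G) 0 M' := by
  refine ⟨?_, by rw [h.eq_of_lt (Nat.lt_succ_self n), hM.total], fun u hu hu' j hj => ?_,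
    fun u hu hu' => ?_, fun u hu hu' => by omega, fun u hu hu' => by omega⟩
  · rw [h.2 0 fun v _ _ => (name_pos v).ne', hM.zero]
  · obtain ⟨v, rfl⟩ := exists_name hu hu'
    have : n + 2 ≤ target n (nameLists G) (name v) := (layout G rfl).le_pos v
    rw [h.eq_of_lt (by omega), hM.list _ hu hu' j hj]
  · obtain ⟨v, rfl⟩ := exists_name hu hu'
    by_cases hv : v ∈ W
    · right
      rw [h.1 v hv (Finset.notMem_empty v), InPlaceDFS.mark, nameLists_name]
      simp
    · left
      rw [h.2 _ fun u hu _ e => hv ((name_inj (v := v)).1 e ▸ hu), hM.table _ hu hu']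

/-- Either search, with the numbers of steps of its phases added up. -/
theorem restoresAndCalls (s : Fin n) (full : Bool) {w : ℕ}
    (hw : n + ∑ u, (adjArray G u).length + 2 < 2 ^ w) :
    ∃ τ, (if full then IsDFSForest G s τ else IsDFSFrom G s τ) ∧
      (prog full).RestoresAndCalls w (sortedRep G) (name s)
        (139 * n + 73 * ∑ u, (adjArray G u).length) τ := by
  have hL := sortedLists_nameLists G
  have hn : 0 < n := s.pos
  have hstart := start_last G
  let E : Env := ⟨full, start n (nameLists G) (n + 1), w, by omega⟩
  have hmem {M : ℕ → ℕ} (hM : IsInput n (nameLists G) M) :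
      (List.range E.N).map M = sortedRep G :=
    (hM.eq_rep hL n le_rfl).trans (sortedRep_eq G).symm
  have hG (v : Fin n) : (swapLast (adjArray G v)).Nodup ∧
      ∀ x, x ∈ swapLast (adjArray G v) ↔ G.Adj v x := by
    refine ⟨(swapLast_perm _).nodup_iff.2 ((List.nodup_finRange n).filter _), fun x => ?_⟩
    rw [(swapLast_perm _).mem_iff]
    simp [adjArray]
  obtain ⟨M₀, hM₀⟩ : ∃ M, IsInput n (nameLists G) M := ⟨_, isInput_rep hL⟩
  obtain ⟨M₁, t, p, d, x, i, g₁, g₂⟩ := steps_rearrange (E := E) hL rfl hn (s := name s) hM₀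
  obtain ⟨W, τ, M₂, K, c', a', b', d', f', v', t', x', i', h₁, h₂, h₃, h₄⟩ :=
    steps_search (E := E) (B := bound n (nameLists G)) (y := s) (a := p) (b := 0) (d := d) (f := 0)
      (v := 0) (t := t) (x := x) (i := i) (layout G rfl) hG g₁.intact
  obtain ⟨M₃, R, k₁, k₂⟩ := steps_restore (E := E) hL rfl hn (c := c') (p := a') (r := b') (s := d')
    (f := f') (d := v') (t := t') (x := x') (i := i') (τ := τ) (h₂.back1 G g₁)
  obtain ⟨T, hT, hrun⟩ := (g₂.trans h₄).trans k₂
  have hweight : weight (fun v => swapLast (adjArray G v)) Finset.univ =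
      ∑ u, (adjArray G u).length + n := by
    simp [weight, Finset.sum_add_distrib]
  have hE : E.N = n + 2 + ∑ u, (adjArray G u).length := hstart
  refine ⟨τ, h₁, T, by omega, St.conf E.N ⟨162, R, M₃, τ⟩, ?_, rfl, hmem k₁, rfl⟩
  have hinit : (prog full).init (sortedRep G) (name s) =
      St.conf E.N ⟨0, ⟨name s, 0, 0, 0, 0, 0, 0, 0, 0, 0, 0, 0, 0, 0⟩, M₀, []⟩ := by
    rw [St.conf, hmem hM₀, Program.init]
    congr 1
    funext r
    fin_cases r <;> rfl
  rw [hinit]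
  exact hrun

end Main

end InPlaceDFS

theorem mainTheorem1 :
    ∃ (P Q : Program) (C : ℕ),
      (∀ (n : ℕ) (G : Digraph (Fin n)) (s : Fin n),
        (sortedRep G).length = n + numArcs G + 2 ∧
        ∀ w : ℕ, n + numArcs G + 2 < 2 ^ w →
          (∃ τ, IsDFSFrom G s τ ∧
            P.RestoresAndCalls w (sortedRep G) (name s) (C * (n + numArcs G)) τ) ∧
          (∃ τ, IsDFSForest G s τ ∧
            Q.RestoresAndCalls w (sortedRep G) (name s) (C * (n + numArcs G)) τ)) ∧
      (∀ (n : ℕ) (G : SimpleGraph (Fin n)) (s : Fin n),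
        (sortedRep (bidirected G)).length = n + 2 * G.edgeSet.ncard + 2 ∧
        ∀ w : ℕ, n + 2 * G.edgeSet.ncard + 2 < 2 ^ w →
          (∃ τ, IsDFSFrom (bidirected G) s τ ∧
            P.RestoresAndCalls w (sortedRep (bidirected G)) (name s)
              (C * (n + G.edgeSet.ncard)) τ) ∧
          (∃ τ, IsDFSForest (bidirected G) s τ ∧
            Q.RestoresAndCalls w (sortedRep (bidirected G)) (name s)
              (C * (n + G.edgeSet.ncard)) τ)) := by
  have key {n : ℕ} (G : Digraph (Fin n)) (s : Fin n) (full : Bool) {m w C : ℕ}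
      (hm : ∑ u, (adjArray G u).length = m) (hw : n + m + 2 < 2 ^ w)
      (hC : 139 * n + 73 * m ≤ C) :
      ∃ τ, (if full then IsDFSForest G s τ else IsDFSFrom G s τ) ∧
        (prog full).RestoresAndCalls w (sortedRep G) (name s) C τ := by
    subst hm
    obtain ⟨τ, h, t, ht, hrun⟩ := restoresAndCalls G s full hw
    exact ⟨τ, h, t, ht.trans hC, hrun⟩
  refine ⟨prog false, prog true, 146, fun n G s => ⟨?_, fun w hw => ?_⟩,
    fun n G s => ⟨?_, fun w hw => ?_⟩⟩
  · rw [length_sortedRep, sum_length_adjArray]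
    omega
  · have hm := sum_length_adjArray G
    exact ⟨key G s false hm hw (by omega), key G s true hm hw (by omega)⟩
  · rw [length_sortedRep, sum_length_bidirected]
    omega
  · have hm := sum_length_bidirected G
    exact ⟨key _ s false hm hw (by omega), key _ s true hm hw (by omega)⟩
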